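/- Let $S=\mathbb{C}[x,y,z]$ and let $S_m$ be its space of homogeneous polynomials of degree $m$. Let $d\ge 1$, and let $X(d)\subset \mathbb{P}(S_1)^d$ be the set of $d$-tuples $(\ell_1,\dots,\ell_d)$ of pairwise distinct lines in $\mathbb{P}^2$, each line being identified with the class of its equation. Let $\psi:\mathbb{P}(S_1)^d\to\mathbb{P}(S_d)$ be the map $(\ell_1,\dots,\ell_d)\mapsto \ell_1\cdots\ell_d$, and put $A(d)=\psi(X(d))$. The group $G=\mathrm{Aut}(\mathbb{P}^2)=PGL(3,\mathbb{C})$ acts by linear change of coordinates on $\mathbb{P}(S_d)$, and diagonally on $\mathbb{P}(S_1)^d$. For a form $f$, let $mdr(f)$ be the smallest integer $r\ge 0$ for which there is a nontrivial relation $af_x+bf_y+cf_z=0$ with $a,b,c\in S_r$. Dimensions are dimensions of algebraic varieties, that is, Krull dimensions for the Zariski topology. Let $(\ell_1,\dots,\ell_d)\in X(d)$ and $f=\psi(\ell_1,\dots,\ell_d)\in A(d)$. Then: 1. $\dim G\cdot(\ell_1,\dots,\ell_d)=\dim G\cdot f$. 2. If $d=1$, then $\dim G\cdot f=2$. If $d=2$,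 then $\dim G\cdot f=4$. If $d=3$, then $\dim G\cdot f=5$ when the three lines are concurrent, and $\dim G\cdot f=6$ when they form a triangle (that is, are not concurrent). 3. If $d\ge 4$, then $\dim G\cdot f=5$ if $mdr(f)=0$, $\dim G\cdot f=7$ if $mdr(f)=1$, and $\dim G\cdot f=8$ if $mdr(f)>1$. -/

import Mathlib

open scoped LinearAlgebra.Projectivization MatrixGroups

noncomputable section

namespace LineArrangement

open MvPolynomial

/-! ### Zariski topology and dimension -/

section Zariski

variable (V : Type*) [AddCommGroup V] [Module ℂ V]

/-- The algebra of polynomial functions on a complex vector space `V`: the functions `V → ℂ` that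
are polynomial expressions in linear forms. -/
def polyFun : Subalgebra ℂ (V → ℂ) :=
  Algebra.adjoin ℂ (Set.range fun φ : Module.Dual ℂ V => (φ : V → ℂ))

/-- The common zero locus of a set of functions. -/
def zeroLocus {V : Type*} (T : Set (V → ℂ)) : Set V := {v | ∀ p ∈ T, p v = 0}

/-- The Zariski topology of the affine space `V`: the closed sets are the common zero loci of
sets of polynomial functions. -/
@[reducible] def zariski : TopologicalSpace V :=
  TopologicalSpace.ofClosed {Z | ∃ T : Set (V → ℂ), T ⊆ polyFun V ∧ Z = zeroLocus T}
    ⟨{1}, by simp, by ext v; simp [zeroLocus]⟩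
    (by
      intro A hA
      have hA' : ∀ Z : Set V, ∃ T : Set (V → ℂ),
          Z ∈ A → T ⊆ polyFun V ∧ Z = zeroLocus T := by
        intro Z
        by_cases h : Z ∈ A
        · obtain ⟨T, hT⟩ := hA h
          exact ⟨T, fun _ => hT⟩
        · exact ⟨∅, fun h' => absurd h' h⟩
      choose T hTZ using hA'
      have hT : ∀ Z ∈ A, T Z ⊆ polyFun V := fun Z h => (hTZ Z h).1
      have hZ : ∀ Z ∈ A, Z = zeroLocus (T Z) := fun Z h => (hTZ Z h).2
      refine ⟨⋃ Z ∈ A, T Z, by simpa using hT, ?_⟩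
      ext v
      simp only [Set.mem_sInter, zeroLocus, Set.mem_iUnion, Set.mem_ofPred_eq]
      constructor
      · rintro h p ⟨Z, hZA, hp⟩
        have := h Z hZA
        rw [hZ Z hZA] at this
        exact this p hp
      · intro h Z hZA
        rw [hZ Z hZA]
        exact fun p hp => h p ⟨Z, hZA, hp⟩)
    (by
      rintro _ ⟨T, hT, rfl⟩ _ ⟨U, hU, rfl⟩
      refine ⟨{r | ∃ p ∈ T, ∃ q ∈ U, r = p * q}, ?_, ?_⟩
      · rintro _ ⟨p, hp, q, hq, rfl⟩
        exact mul_mem (hT hp) (hU hq)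
      · ext v
        simp only [zeroLocus, Set.mem_union, Set.mem_ofPred_eq]
        constructor
        · rintro (h | h) _ ⟨p, hp, q, hq, rfl⟩
          · simp [h p hp]
          · simp [h q hq]
        · intro h
          by_contra! hcon
          obtain ⟨⟨p, hp, hpv⟩, q, hq, hqv⟩ := hcon
          have := h _ ⟨p, hp, q, hq, rfl⟩
          simp_all)

/-- The Zariski topology of the projective space `ℙ(V)`: a set is closed iff the cone over it is
Zariski closed in `V \ {0}` (equivalently, iff it is the zero locus of homogeneous polynomials). -/
@[reducible] def zariskiProj : TopologicalSpace (ℙ ℂ V) :=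
  TopologicalSpace.coinduced (fun v : {v : V // v ≠ 0} => Projectivization.mk ℂ v.1 v.2)
    (TopologicalSpace.induced Subtype.val (zariski V))

/-- The Zariski topology of the product variety `ℙ(V) × ⋯ × ℙ(V)` (not the product topology):
a set is closed iff the multicone over it is Zariski closed in `(V \ {0}) × ⋯ × (V \ {0})`
(equivalently, iff it is the zero locus of multihomogeneous polynomials). -/
@[reducible] def zariskiProjPow (n : ℕ) : TopologicalSpace (Fin n → ℙ ℂ V) :=
  TopologicalSpace.coinduced
    (fun (v : {v : Fin n → V // ∀ i, v i ≠ 0}) (i : Fin n) =>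
      Projectivization.mk ℂ (v.1 i) (v.2 i))
    (TopologicalSpace.induced Subtype.val (zariski (Fin n → V)))

variable {V}

/-- The dimension of a subset of `ℙ(V)`: its Krull dimension in the Zariski topology. -/
def dimProj (Z : Set (ℙ ℂ V)) : WithBot ℕ∞ :=
  letI : TopologicalSpace (ℙ ℂ V) := zariskiProj V
  topologicalKrullDim Z

/-- The dimension of a subset of `ℙ(V) × ⋯ × ℙ(V)`: its Krull dimension in the Zariski
topology of the product variety. -/
def dimProjPow {n : ℕ} (Z : Set (Fin n → ℙ ℂ V)) : WithBot ℕ∞ :=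
  letI : TopologicalSpace (Fin n → ℙ ℂ V) := zariskiProjPow V n
  topologicalKrullDim Z

end Zariski

/-! ### Ternary forms and the action of `PGL(3, ℂ)` -/

/-- The space `S_d` of ternary forms of degree `d` over `ℂ`. -/
abbrev Form (d : ℕ) : Type := homogeneousSubmodule (Fin 3) ℂ d

/-- The substitution `F ↦ F(Mx)`, for a `3 × 3` matrix `M`. -/
def subst (M : Matrix (Fin 3) (Fin 3) ℂ) :
    MvPolynomial (Fin 3) ℂ →ₐ[ℂ] MvPolynomial (Fin 3) ℂ :=
  aeval fun i => ∑ j, C (M i j) * X j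

lemma subst_homogeneous (M : Matrix (Fin 3) (Fin 3) ℂ) {d : ℕ} {F : MvPolynomial (Fin 3) ℂ}
    (hF : F.IsHomogeneous d) : (subst M F).IsHomogeneous d := by
  have := IsHomogeneous.aeval (R := ℂ) hF (fun i => ∑ j, C (M i j) * X j) (n := 1)
    (fun i => IsHomogeneous.sum _ _ _ fun j _ => isHomogeneous_C_mul_X _ _)
  rwa [one_mul] at this

lemma subst_one (F : MvPolynomial (Fin 3) ℂ) : subst 1 F = F := by
  have : subst 1 = AlgHom.id ℂ _ := by
    ext1 i
    simp [subst, Matrix.one_apply]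
  rw [this]; rfl

lemma subst_mul (M N : Matrix (Fin 3) (Fin 3) ℂ) (F : MvPolynomial (Fin 3) ℂ) :
    subst (M * N) F = subst N (subst M F) := by
  have : subst (M * N) = (subst N).comp (subst M) := by
    ext1 i
    simp only [subst, aeval_X, AlgHom.comp_apply, map_sum, map_mul, Matrix.mul_apply,
      Finset.sum_mul, Finset.mul_sum, algHom_C, algebraMap_eq]
    rw [Finset.sum_comm]
    simp [mul_assoc]
  rw [this]; rfl

/-- `GL(3, ℂ)` acts linearly on forms by `(g • F)(x) = F(g⁻¹ x)`. -/
instance (d : ℕ) : DistribMulAction (GL (Fin 3) ℂ) (Form d) where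
  smul g F := ⟨subst (g⁻¹ : GL (Fin 3) ℂ).1 F.1, subst_homogeneous _ F.2⟩
  one_smul F := Subtype.ext (by change subst (1⁻¹ : GL (Fin 3) ℂ).1 F.1 = F.1; simp [subst_one])
  mul_smul g h F := Subtype.ext (by
    change subst ((g * h)⁻¹ : GL (Fin 3) ℂ).1 F.1 = subst _ (subst _ F.1)
    rw [← subst_mul, mul_inv_rev]; rfl)
  smul_zero g := Subtype.ext (map_zero (subst _))
  smul_add g F H := Subtype.ext (map_add (subst _) F.1 H.1)

lemma coe_smul_form {d : ℕ} (g : GL (Fin 3) ℂ) (F : Form d) :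
    ((g • F : Form d) : MvPolynomial (Fin 3) ℂ) = subst (g⁻¹ : GL (Fin 3) ℂ).1 F.1 := rfl

instance (d : ℕ) : SMulCommClass (GL (Fin 3) ℂ) ℂ (Form d) where
  smul_comm g c F := Subtype.ext (map_smul (subst (g⁻¹ : GL (Fin 3) ℂ).1) c F.1)

lemma subst_scalar (c : ℂ) {d : ℕ} {F : MvPolynomial (Fin 3) ℂ} (hF : F.IsHomogeneous d) :
    subst (Matrix.scalar (Fin 3) c) F = c ^ d • F := by
  have h1 : ∀ i : Fin 3, (∑ j, C (Matrix.scalar (Fin 3) c i j) * X j : MvPolynomial (Fin 3) ℂ)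
      = C c * X i := by
    intro i
    simp only [Matrix.scalar_apply, Matrix.diagonal_apply]
    rw [Finset.sum_eq_single i] <;> simp +contextual [eq_comm]
  simp only [subst, h1]
  rw [F.as_sum, map_sum, Finset.smul_sum]
  refine Finset.sum_congr rfl fun m hm => ?_
  have hd : m.degree = d := by
    by_contra hne
    exact (mem_support_iff.1 hm) (hF.coeff_eq_zero hne)
  rw [aeval_monomial]
  simp only [mul_pow, Finsupp.prod, Finset.prod_mul_distrib, algebraMap_eq]
  rw [monomial_eq, Finset.prod_pow_eq_pow_sum]
  have : ∑ i ∈ m.support, m i = d := hd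
  rw [this, Finsupp.prod, smul_eq_C_mul, map_pow]
  ring

/-- The induced action of `G = PGL(3, ℂ) = Aut(ℙ²)` on the parameter space `ℙ(S_d)` of plane
curves of degree `d`; it acts on tuples of points of `ℙ(S_d)` diagonally. -/
instance (d : ℕ) : MulAction PGL(3, ℂ) (ℙ ℂ (Form d)) :=
  Matrix.ProjGenLinGroup.mulActionOfGL fun u => Projectivization.ind fun F hF => by
    rw [Projectivization.smul_mk, Projectivization.mk_eq_mk_iff]
    refine ⟨(u⁻¹) ^ d, Subtype.ext ?_⟩
    have h : ((Matrix.GeneralLinearGroup.scalar (Fin 3) u)⁻¹ : GL (Fin 3) ℂ).1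
        = Matrix.scalar (Fin 3) ((u⁻¹ : ℂˣ) : ℂ) := by
      rw [← map_inv]; rfl
    rw [coe_smul_form, h, subst_scalar _ F.2, Units.smul_def]
    simp

/-! ### Line arrangements -/

/-- The space `X(d)` of ordered `d`-tuples of distinct lines in `ℙ²`, a line being given by the
class of its equation in `ℙ(S_1)`. -/
def X (d : ℕ) : Set (Fin d → ℙ ℂ (Form 1)) := {l | Function.Injective l}

/-- The product of `d` linear forms. -/
def prodForm {d : ℕ} (l : Fin d → Form 1) : Form d :=
  ⟨∏ i, (l i).1, by
    have := IsHomogeneous.prod Finset.univ (fun i => (l i).1) (fun _ => 1) fun i _ => (l i).2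
    simpa using this⟩

lemma prodForm_ne_zero {d : ℕ} {l : Fin d → Form 1} (hl : ∀ i, l i ≠ 0) : prodForm l ≠ 0 := by
  intro h
  have h' : ∏ i, (l i).1 = 0 := congrArg Subtype.val h
  obtain ⟨i, -, hi⟩ := Finset.prod_eq_zero_iff.1 h'
  exact hl i (Subtype.ext hi)

/-- The map `ψ : ℙ(S_1)^d → ℙ(S_d)`, `(ℓ₁, …, ℓ_d) ↦ ℓ₁ ⋯ ℓ_d`. -/
def psi {d : ℕ} (l : Fin d → ℙ ℂ (Form 1)) : ℙ ℂ (Form d) :=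
  Projectivization.mk ℂ (prodForm fun i => (l i).rep)
    (prodForm_ne_zero fun i => (l i).rep_nonzero)

/-- `psi` does not depend on the choice of the equations of the lines. -/
lemma psi_mk {d : ℕ} (l : Fin d → Form 1) (hl : ∀ i, l i ≠ 0) :
    psi (fun i => Projectivization.mk ℂ (l i) (hl i)) =
      Projectivization.mk ℂ (prodForm l) (prodForm_ne_zero hl) := by
  choose a ha using fun i => Projectivization.exists_smul_eq_mk_rep ℂ (l i) (hl i)
  rw [psi, Projectivization.mk_eq_mk_iff]
  refine ⟨∏ i, a i, Subtype.ext ?_⟩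
  simp only [prodForm, ← ha]
  change (∏ i, a i) • ∏ i, (l i).1 = ∏ i, (a i) • (l i).1
  simp only [Units.smul_def, smul_eq_C_mul, Finset.prod_mul_distrib, Units.coe_prod, map_prod]

/-- The lines `ℓ₁, …, ℓ_d` are concurrent: some point of `ℙ²` lies on all of them. -/
def Concurrent {d : ℕ} (l : Fin d → ℙ ℂ (Form 1)) : Prop :=
  ∃ p : Fin 3 → ℂ, p ≠ 0 ∧ ∀ i, eval p (l i).rep.1 = 0

/-! ### Jacobian syzygies -/

/-- There is a nontrivial relation `a f_x + b f_y + c f_z = 0` with `a, b, c ∈ S_r`. -/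
def HasJacobianSyzygy (f : MvPolynomial (Fin 3) ℂ) (r : ℕ) : Prop :=
  ∃ a : Fin 3 → Form r, a ≠ 0 ∧ ∑ i, (a i).1 * pderiv i f = 0

/-- The minimal degree `mdr(f)` of a Jacobian syzygy of a form `f`, taken up to scalars. -/
def mdr {d : ℕ} (f : ℙ ℂ (Form d)) : ℕ := sInf {r | HasJacobianSyzygy f.rep.1 r}

/-- `mdr` may be computed from any equation of the curve. -/
lemma mdr_mk {d : ℕ} (F : Form d) (hF : F ≠ 0) :
    mdr (Projectivization.mk ℂ F hF) = sInf {r | HasJacobianSyzygy F.1 r} := by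
  obtain ⟨c, hc⟩ := Projectivization.exists_smul_eq_mk_rep ℂ F hF
  have h : ∀ r, HasJacobianSyzygy (Projectivization.mk ℂ F hF).rep.1 r ↔
      HasJacobianSyzygy F.1 r := by
    intro r
    have : (Projectivization.mk ℂ F hF).rep.1 = (c : ℂ) • F.1 := by rw [← hc]; rfl
    simp only [HasJacobianSyzygy, this, (pderiv _).map_smul, mul_smul_comm]
    simp only [← Finset.smul_sum, smul_eq_zero, c.ne_zero, false_or]
  simp only [mdr, h]

/-- Jacobian syzygies exist (in degree `d - 1` at the latest), so `mdr` is a genuine minimum. -/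
lemma exists_hasJacobianSyzygy {d : ℕ} (F : Form d) : ∃ r, HasJacobianSyzygy F.1 r := by
  have hd : ∀ i, (pderiv i F.1).IsHomogeneous (d - 1) := fun i => IsHomogeneous.pderiv F.2
  by_cases h : pderiv 0 F.1 = 0
  · refine ⟨0, ![⟨1, isHomogeneous_one _ _⟩, 0, 0], fun h0 => ?_, ?_⟩
    · have := congrArg Subtype.val (congrFun h0 0)
      simp at this
    · simp [Fin.sum_univ_three, h]
  · refine ⟨d - 1, ![⟨-pderiv 1 F.1, (hd 1).neg⟩, ⟨pderiv 0 F.1, hd 0⟩, 0], fun h0 => ?_, ?_⟩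
    · exact h (by simpa using congrArg Subtype.val (congrFun h0 1))
    · simp [Fin.sum_univ_three]
      ring

end LineArrangement

end

/-! The proof is a sandwich; no stabilizer is computed. For each type of arrangement, with expected
dimension `k`, the orbit of the tuple has dimension at least `k` and the orbit of the product at
most `k`. Since the orbit of the tuple is never larger than that of the product
(`dimProjPow_orbit_le`), both dimensions equal `k`, which gives the equality of dimensions and the
values together.

The comparison rests on finiteness of `psi`. Among lines avoiding a point `p`, with equations
normalized to be `1` at `p`, the restriction of the product to a line through `p` is a monic
polynomial whose roots are values of the factors. So the factors are integral over the coefficients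
of the product (`exists_monic_chart`), and incomparability of primes in integral extensions keeps
strict chains of irreducible sets strict (`not_image_psi_subset_closure`).

Lower bounds (`le_dimProjPow_orbit`): `k` affine coordinates of the moved lines can be prescribed
independently by a matrix polynomial in them, and freeing them one at a time produces a chain of
irreducible sets. Upper bounds (`dimProj_le`): the cone over the orbit lies in the closure of the
image of a polynomial map in `k + 1` parameters, and a chain of primes yields algebraically
independent functions (`aeval_notMem_of_prime_chain`), so transcendence degree bounds its length.

For `d ≥ 4` the lines are concurrent, or all but one are, or four of them are in general position
(`concurrent_or_near_pencil_or_hasFrame`). A Jacobian syzygy is a vector field tangent to every line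
(`tangent_of_syzygy`). A nonzero constant one exists exactly for concurrent lines; a near pencil has
a linear one; four lines in general position force a linear one to be a multiple of the Euler field,
which does not kill `f`. Hence `mdr` is `0`, `1` or larger, and the dimensions are 5, 7, 8. -/

/-! ### Chains of irreducible subsets -/

/-- The Krull dimension of a subspace, in terms of chains of irreducible subsets that need not be
closed. -/
theorem le_topologicalKrullDim_subtype_iff {Y : Type*} [TopologicalSpace Y] {Z : Set Y} {n : ℕ} :
    (n : WithBot ℕ∞) ≤ topologicalKrullDim Z ↔
      ∃ S : ℕ → Set Y, (∀ i ≤ n, IsIrreducible (S i) ∧ S i ⊆ Z) ∧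
        ∀ i < n, S i ⊆ S (i + 1) ∧ ¬ S (i + 1) ⊆ closure (S i) := by
  rw [topologicalKrullDim, Order.le_krullDim_iff]
  constructor
  · rintro ⟨c, rfl⟩
    refine ⟨fun i => if h : i < c.length + 1 then Subtype.val '' (c ⟨i, h⟩ : Set Z) else ∅,
      fun i hi => ?_, fun i hi => ?_⟩
    · dsimp only
      rw [dif_pos (Nat.lt_succ_of_le hi)]
      exact ⟨(c _).isIrreducible.image _ continuous_subtype_val.continuousOn,
        Subtype.coe_image_subset _ _⟩
    · dsimp only
      rw [dif_pos (show i < c.length + 1 by omega), dif_pos (show i + 1 < c.length + 1 by omega)]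
      have hlt : c ⟨i, by omega⟩ < c ⟨i + 1, by omega⟩ := c.strictMono (by simp)
      refine ⟨Set.image_mono hlt.le, fun hsub => hlt.not_ge ?_⟩
      intro z hz
      have h1 : (z : Y) ∈ closure (Subtype.val '' (c ⟨i, by omega⟩ : Set Z)) :=
        hsub ⟨z, hz, rfl⟩
      rw [← closure_subtype, (c _).isClosed.closure_eq] at h1
      exact h1
  · rintro ⟨S, hS, hS'⟩
    have himg : ∀ i ≤ n, Subtype.val '' ((Subtype.val : Z → Y) ⁻¹' S i) = S i := fun i hi => by
      rw [Subtype.image_preimage_coe, Set.inter_eq_right]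
      exact (hS i hi).2
    have hirr : ∀ i ≤ n, IsIrreducible ((Subtype.val : Z → Y) ⁻¹' S i) := by
      intro i hi
      obtain ⟨⟨⟨y, hy⟩, hpre⟩, hZ⟩ := hS i hi
      refine ⟨⟨⟨y, hZ hy⟩, hy⟩, ?_⟩
      rintro _ _ ⟨u, hu, rfl⟩ ⟨v, hv, rfl⟩ ⟨a, ha, hau⟩ ⟨b, hb, hbv⟩
      obtain ⟨w, hw, hwuv⟩ := hpre u v hu hv ⟨a, ha, hau⟩ ⟨b, hb, hbv⟩
      exact ⟨⟨w, hZ hw⟩, hw, hwuv⟩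
    -- Closures in the subspace are traces of closures in `Y`, so the second half of the chain
    -- condition is exactly strictness of these closures.
    let T : ℕ → Set Z := fun i => closure (Subtype.val ⁻¹' S i)
    have hstep : ∀ i < n, T i ⊆ T (i + 1) ∧ ¬ T (i + 1) ⊆ T i := by
      intro i hi
      refine ⟨closure_mono (Set.preimage_mono (hS' i hi).1), fun hsub => (hS' i hi).2 ?_⟩
      intro y hy
      have hyZ := (hS (i + 1) hi).2 hy
      have h1 : (⟨y, hyZ⟩ : Z) ∈ T i := hsub (subset_closure hy)
      have h2 := closure_subtype.1 h1
      rwa [himg i hi.le] at h2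
    refine ⟨⟨n, fun i => ⟨T i, (hirr i (by omega)).closure, isClosed_closure⟩, fun i => ?_⟩, rfl⟩
    have h := hstep i i.2
    exact lt_of_le_not_ge h.1 h.2

/-! ### Chains of primes and algebraic independence -/

/-- Elements picked along a strictly increasing chain of primes are algebraically independent
modulo the smallest one. -/
theorem aeval_notMem_of_prime_chain {k A : Type*} [Field k] [CommRing A] [Algebra k A] (n : ℕ)
    (P : ℕ → Ideal A) (x : ℕ → A) (hP : ∀ i ≤ n, (P i).IsPrime)
    (hle : ∀ i < n, P i ≤ P (i + 1)) (hx : ∀ i < n, x i ∈ P (i + 1) ∧ x i ∉ P i)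
    (f : MvPolynomial (Fin n) k) (hf : f ≠ 0) :
    MvPolynomial.aeval (fun i : Fin n => x i) f ∉ P 0 := by
  induction n generalizing P x with
  | zero =>
    obtain ⟨c, rfl⟩ := MvPolynomial.C_surjective (Fin 0) f
    have hc : c ≠ 0 := by rintro rfl; simp at hf
    rw [MvPolynomial.aeval_C]
    intro h
    exact (hP 0 le_rfl).ne_top (Ideal.eq_top_of_isUnit_mem _ h
      ((isUnit_iff_ne_zero.2 hc).map (algebraMap k A)))
  | succ n ih =>
    have ih' := ih (fun i => P (i + 1)) (fun i => x (i + 1)) (fun i hi => hP _ (by omega))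
      (fun i hi => hle _ (by omega)) (fun i hi => hx _ (by omega))
    let φ : MvPolynomial (Fin n) k →ₐ[k] A := MvPolynomial.aeval fun i : Fin n => x (i + 1)
    let g := MvPolynomial.finSuccEquiv k n f
    have hg : g ≠ 0 := by simpa [g] using hf
    have heval : MvPolynomial.aeval (fun i : Fin (n + 1) => x i) f
        = g.eval₂ (φ : MvPolynomial (Fin n) k →+* A) (x 0) := by
      have : ((MvPolynomial.aeval (fun i : Fin (n + 1) => x i) :
          MvPolynomial (Fin (n + 1)) k →ₐ[k] A) : MvPolynomial (Fin (n + 1)) k →+* A) =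
          (Polynomial.eval₂RingHom (φ : MvPolynomial (Fin n) k →+* A) (x 0)).comp
            (MvPolynomial.finSuccEquiv k n : MvPolynomial (Fin (n + 1)) k →+* _) := by
        refine MvPolynomial.ringHom_ext (fun c => ?_) fun i => ?_
        · simp [MvPolynomial.finSuccEquiv_apply, φ]
        · refine Fin.cases ?_ (fun j => ?_) i
          · simp [MvPolynomial.finSuccEquiv_X_zero]
          · simp [MvPolynomial.finSuccEquiv_X_succ, φ]
      exact congrArg (fun ψ : MvPolynomial (Fin (n + 1)) k →+* A => ψ f) this
    -- Strip the largest power of the first variable. As `x 0 ∉ P 0` and `P 0` is prime, the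
    -- cofactor `q` also takes its value in `P 0`. Modulo `P 1`, which contains `x 0`, only the
    -- constant coefficient of `q` survives; it is nonzero, against the induction hypothesis for the
    -- shifted chain.
    obtain ⟨q, hq, hndvd⟩ := Polynomial.exists_eq_pow_rootMultiplicity_mul_and_not_dvd g hg 0
    rw [heval, hq]
    have hp0 := hP 0 (by omega)
    intro hmem
    rw [Polynomial.eval₂_mul, Polynomial.eval₂_pow] at hmem
    have hx0 := hx 0 (by omega)
    have hq0 : q.eval₂ (φ : MvPolynomial (Fin n) k →+* A) (x 0) ∈ P 0 := by
      refine (hp0.mem_or_mem hmem).resolve_left fun h => hx0.2 ?_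
      simpa using hp0.mem_of_pow_mem _ h
    have hc : q.coeff 0 ≠ 0 := by
      intro h
      apply hndvd
      simpa [Polynomial.X_dvd_iff] using h
    apply ih' _ hc
    have hdec := congrArg (Polynomial.eval₂ (φ : MvPolynomial (Fin n) k →+* A) (x 0))
      (Polynomial.divX_mul_X_add q)
    rw [Polynomial.eval₂_add, Polynomial.eval₂_mul, Polynomial.eval₂_X, Polynomial.eval₂_C] at hdec
    have h1 := hle 0 (by omega) hq0
    rw [← hdec] at h1
    exact ((P 1).add_mem_iff_right (Ideal.mul_mem_left _ _ hx0.1)).1 h1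

namespace LineArrangement

open scoped Topology Matrix

/-! ### Polynomial functions -/

section PolyFun

variable {V W : Type*} [AddCommGroup V] [Module ℂ V] [AddCommGroup W] [Module ℂ W]

theorem dual_mem_polyFun (φ : Module.Dual ℂ V) : (φ : V → ℂ) ∈ polyFun V :=
  Algebra.subset_adjoin ⟨φ, rfl⟩

/-- A map is polynomial if its composition with every linear form is a polynomial function. -/
@[fun_prop]
def IsPolyMap (f : W → V) : Prop := ∀ φ : Module.Dual ℂ V, (fun w => φ (f w)) ∈ polyFun W

theorem IsPolyMap.comp_mem {f : W → V} (hf : IsPolyMap f) {q : V → ℂ} (hq : q ∈ polyFun V) :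
    (fun w => q (f w)) ∈ polyFun W := by
  induction hq using Algebra.adjoin_induction with
  | mem q hq => obtain ⟨φ, rfl⟩ := hq; exact hf φ
  | algebraMap c => exact (polyFun W).algebraMap_mem c
  | add p q _ _ hp hq => exact add_mem hp hq
  | mul p q _ _ hp hq => exact mul_mem hp hq

theorem isPolyMap_linear (f : W →ₗ[ℂ] V) : IsPolyMap f := fun φ =>
  dual_mem_polyFun (φ.comp f)

theorem const_mem_polyFun (c : ℂ) : (fun _ : V => c) ∈ polyFun V :=
  (polyFun V).algebraMap_mem c

/-- Polynomial functions restrict to polynomials on lines. -/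
theorem exists_polynomial_line {q : V → ℂ} (hq : q ∈ polyFun V) (v w : V) :
    ∃ p : Polynomial ℂ, ∀ s : ℂ, p.eval s = q (v + s • w) := by
  induction hq using Algebra.adjoin_induction with
  | mem q hq =>
    obtain ⟨φ, rfl⟩ := hq
    exact ⟨.C (φ v) + .X * .C (φ w), fun s => by simp; ring⟩
  | algebraMap c => exact ⟨.C c, fun s => by simp⟩
  | add p q _ _ hp hq =>
    obtain ⟨p', hp⟩ := hp
    obtain ⟨q', hq⟩ := hq
    exact ⟨p' + q', fun s => by simp [hp, hq]⟩
  | mul p q _ _ hp hq =>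
    obtain ⟨p', hp⟩ := hp
    obtain ⟨q', hq⟩ := hq
    exact ⟨p' * q', fun s => by simp [hp, hq]⟩

/-- The ring of polynomial functions has no zero divisors. -/
theorem polyFun_mul_ne_zero {p q : V → ℂ} (hp : p ∈ polyFun V) (hq : q ∈ polyFun V)
    (hp0 : ∃ v, p v ≠ 0) (hq0 : ∃ v, q v ≠ 0) : ∃ v, p v * q v ≠ 0 := by
  obtain ⟨v, hv⟩ := hp0
  obtain ⟨w, hw⟩ := hq0
  -- On the line from `v` to `w`, one restriction is nonzero at parameter `0` and the other at
  -- parameter `1`, so one-variable polynomials suffice.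
  obtain ⟨p', hp'⟩ := exists_polynomial_line hp v (w - v)
  obtain ⟨q', hq'⟩ := exists_polynomial_line hq v (w - v)
  have h1 : p' ≠ 0 := by rintro rfl; exact hv (by simpa using (hp' 0).symm)
  have h2 : q' ≠ 0 := by rintro rfl; exact hw (by simpa using (hq' 1).symm)
  by_contra! hcon
  apply mul_ne_zero h1 h2
  refine Polynomial.funext fun s => ?_
  simp [hp', hq', hcon]

/-- Density of a nonempty principal open set: a polynomial identity may be checked under a generic
nonvanishing assumption. -/
theorem polyFun_eq_zero_of_mul {p q : V → ℂ} (hp : p ∈ polyFun V) (hq : q ∈ polyFun V)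
    (hp0 : ∃ v, p v ≠ 0) (h : ∀ v, p v ≠ 0 → q v = 0) (v : V) : q v = 0 := by
  by_contra hv
  obtain ⟨w, hw⟩ := polyFun_mul_ne_zero hp hq hp0 ⟨v, hv⟩
  exact hw (by rw [h w (left_ne_zero_of_mul hw), mul_zero])

theorem isClosed_zariski_iff {Z : Set V} :
    IsClosed[zariski V] Z ↔ ∃ T : Set (V → ℂ), T ⊆ polyFun V ∧ Z = zeroLocus T := by
  rw [← @isOpen_compl_iff _ _ (zariski V)]
  change Zᶜᶜ ∈ _ ↔ _
  rw [compl_compl]; rfl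

theorem isClosed_zeros_iInter {ι : Type*} {q : ι → V → ℂ} (hq : ∀ i, q i ∈ polyFun V) :
    IsClosed[zariski V] {v | ∀ i, q i v = 0} :=
  isClosed_zariski_iff.2 ⟨Set.range q, by rintro _ ⟨i, rfl⟩; exact hq i, by
    ext; simp [zeroLocus]⟩

@[fun_prop]
theorem isPolyMap_pi {ι : Type*} [Fintype ι] {f : W → ι → V} (hf : ∀ i, IsPolyMap fun w => f w i) :
    IsPolyMap f := by
  classical
  intro φ
  have : (fun w => φ (f w)) = ∑ i, fun w => (φ.comp (LinearMap.single ℂ (fun _ => V) i)) (f w i) := by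
    ext w
    simp [← map_sum, Finset.univ_sum_single]
  rw [this]
  exact sum_mem fun i _ => hf i _

theorem isPolyMap_complex {f : W → ℂ} : IsPolyMap f ↔ f ∈ polyFun W := by
  refine ⟨fun h => h LinearMap.id, fun h φ => ?_⟩
  have : (fun w => φ (f w)) = φ 1 • f := by
    ext w
    rw [Pi.smul_apply, smul_eq_mul, mul_comm, ← smul_eq_mul, ← map_smul]; simp
  rw [this]
  exact (polyFun W).smul_mem h _

@[fun_prop]
theorem IsPolyMap.comp {U : Type*} [AddCommGroup U] [Module ℂ U] {g : V → U} {f : W → V}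
    (hg : IsPolyMap g) (hf : IsPolyMap f) : IsPolyMap fun w => g (f w) :=
  fun φ => hf.comp_mem (hg φ)

@[fun_prop]
theorem IsPolyMap.id : IsPolyMap fun w : W => w := isPolyMap_linear LinearMap.id

@[fun_prop]
theorem isPolyMap_const (v : V) : IsPolyMap fun _ : W => v := fun φ => const_mem_polyFun (φ v)

@[fun_prop]
theorem isPolyMap_apply {ι : Type*} (i : ι) : IsPolyMap fun f : ι → V => f i :=
  isPolyMap_linear (LinearMap.proj (R := ℂ) (φ := fun _ : ι => V) i)

@[fun_prop]
theorem IsPolyMap.fst {U : Type*} [AddCommGroup U] [Module ℂ U] {f : W → V × U}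
    (hf : IsPolyMap f) : IsPolyMap fun w => (f w).1 :=
  (isPolyMap_linear (LinearMap.fst ℂ V U)).comp hf

@[fun_prop]
theorem IsPolyMap.snd {U : Type*} [AddCommGroup U] [Module ℂ U] {f : W → V × U}
    (hf : IsPolyMap f) : IsPolyMap fun w => (f w).2 :=
  (isPolyMap_linear (LinearMap.snd ℂ V U)).comp hf

@[fun_prop]
theorem IsPolyMap.add {f g : W → V} (hf : IsPolyMap f) (hg : IsPolyMap g) :
    IsPolyMap fun w => f w + g w := fun φ => by
  simp only [map_add]
  exact add_mem (hf φ) (hg φ)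

@[fun_prop]
theorem IsPolyMap.sub {f g : W → V} (hf : IsPolyMap f) (hg : IsPolyMap g) :
    IsPolyMap fun w => f w - g w := fun φ => by
  simp only [map_sub]
  exact sub_mem (hf φ) (hg φ)

@[fun_prop]
theorem IsPolyMap.mul {f g : W → ℂ} (hf : IsPolyMap f) (hg : IsPolyMap g) :
    IsPolyMap fun w => f w * g w :=
  isPolyMap_complex.2 (mul_mem (isPolyMap_complex.1 hf) (isPolyMap_complex.1 hg))

@[fun_prop]
theorem IsPolyMap.smul {f : W → ℂ} {g : W → V} (hf : IsPolyMap f) (hg : IsPolyMap g) :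
    IsPolyMap fun w => f w • g w := fun φ => by
  simp only [map_smul]
  exact mul_mem (isPolyMap_complex.1 hf) (hg φ)

@[fun_prop]
theorem IsPolyMap.sum {ι : Type*} {s : Finset ι} {f : ι → W → V}
    (hf : ∀ i, IsPolyMap (f i)) : IsPolyMap fun w => ∑ i ∈ s, f i w := fun φ => by
  simp only [map_sum]
  have : (fun w => ∑ i ∈ s, φ (f i w)) = ∑ i ∈ s, fun w => φ (f i w) := by ext; simp
  rw [this]
  exact sum_mem fun i _ => hf i φ

@[fun_prop]
theorem IsPolyMap.prod {ι : Type*} {s : Finset ι} {f : ι → W → ℂ}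
    (hf : ∀ i, IsPolyMap (f i)) : IsPolyMap fun w => ∏ i ∈ s, f i w := by
  have : (fun w => ∏ i ∈ s, f i w) = ∏ i ∈ s, f i := by ext; simp
  rw [this]
  exact isPolyMap_complex.2 (prod_mem fun i _ => isPolyMap_complex.1 (hf i))

/-- The polynomial functions on `ℂ^m` are generated by the coordinates. -/
theorem polyFun_pi_eq_adjoin (m : ℕ) :
    polyFun (Fin m → ℂ) = Algebra.adjoin ℂ (Set.range fun (i : Fin m) (t : Fin m → ℂ) => t i) := by
  refine le_antisymm (Algebra.adjoin_le ?_) (Algebra.adjoin_le ?_)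
  · rintro _ ⟨φ, rfl⟩
    have : (φ : (Fin m → ℂ) → ℂ) = ∑ i, φ (Pi.single i 1) • fun t : Fin m → ℂ => t i := by
      ext t
      simp only [Finset.sum_apply, Pi.smul_apply, smul_eq_mul]
      conv_lhs => rw [← Finset.univ_sum_single t, map_sum]
      refine Finset.sum_congr rfl fun i _ => ?_
      have : Pi.single i (t i) = t i • (Pi.single i 1 : Fin m → ℂ) := by
        rw [← Pi.single_smul]; simp
      rw [this, map_smul, smul_eq_mul, mul_comm]
    dsimp only
    rw [SetLike.mem_coe, this]
    exact sum_mem fun i _ => Subalgebra.smul_mem _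
      (Algebra.subset_adjoin (Set.mem_range_self (f := fun (i : Fin m) (t : Fin m → ℂ) => t i) i)) _
  · rintro _ ⟨i, rfl⟩
    exact dual_mem_polyFun (V := Fin m → ℂ) (LinearMap.proj i)

end PolyFun

/-! ### Cone ideals and the upper bound for the dimension of a projective set -/

section ProjClosed

variable {V W : Type*} [AddCommGroup V] [Module ℂ V] [AddCommGroup W] [Module ℂ W]

/-- Pulling back polynomial functions along a polynomial map. -/
noncomputable def IsPolyMap.pullback {f : W → V} (hf : IsPolyMap f) :
    polyFun V →ₐ[ℂ] polyFun W where
  toFun q := ⟨fun w => q.1 (f w), hf.comp_mem q.2⟩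
  map_one' := rfl
  map_mul' _ _ := rfl
  map_zero' := rfl
  map_add' _ _ := rfl
  commutes' _ := rfl

theorem isClosed_zariskiProj {E : Set (ℙ ℂ V)} {ι : Type*} {q : ι → V → ℂ}
    (hq : ∀ i, q i ∈ polyFun V)
    (hE : ∀ v (hv : v ≠ 0), Projectivization.mk ℂ v hv ∈ E ↔ ∀ i, q i v = 0) :
    IsClosed[zariskiProj V] E := by
  rw [zariskiProj, isClosed_coinduced, @isClosed_induced_iff _ _ (zariski V)]
  exact ⟨_, isClosed_zeros_iInter hq, by ext v; exact (hE v.1 v.2).symm⟩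

theorem exists_of_isClosed_zariskiProj {E : Set (ℙ ℂ V)} (hE : IsClosed[zariskiProj V] E) :
    ∃ T ⊆ (polyFun V : Set (V → ℂ)),
      ∀ v (hv : v ≠ 0), Projectivization.mk ℂ v hv ∈ E ↔ ∀ q ∈ T, q v = 0 := by
  rw [zariskiProj, isClosed_coinduced, @isClosed_induced_iff _ _ (zariski V)] at hE
  obtain ⟨Z, hZ, hE⟩ := hE
  obtain ⟨T, hT, rfl⟩ := isClosed_zariski_iff.1 hZ
  exact ⟨T, hT, fun v hv => (Set.ext_iff.1 hE ⟨v, hv⟩).symm⟩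

theorem isClosed_zariskiProjPow {n : ℕ} {E : Set (Fin n → ℙ ℂ V)} {ι : Type*}
    {q : ι → (Fin n → V) → ℂ} (hq : ∀ i, q i ∈ polyFun (Fin n → V))
    (hE : ∀ (v : Fin n → V) (hv : ∀ j, v j ≠ 0),
      (fun j => Projectivization.mk ℂ (v j) (hv j)) ∈ E ↔ ∀ i, q i v = 0) :
    IsClosed[zariskiProjPow V n] E := by
  rw [zariskiProjPow, isClosed_coinduced, @isClosed_induced_iff _ _ (zariski (Fin n → V))]
  exact ⟨_, isClosed_zeros_iInter hq, by ext v; exact (hE v.1 v.2).symm⟩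

theorem exists_of_isClosed_zariskiProjPow {n : ℕ} {E : Set (Fin n → ℙ ℂ V)}
    (hE : IsClosed[zariskiProjPow V n] E) :
    ∃ T ⊆ (polyFun (Fin n → V) : Set ((Fin n → V) → ℂ)),
      ∀ (v : Fin n → V) (hv : ∀ j, v j ≠ 0),
        (fun j => Projectivization.mk ℂ (v j) (hv j)) ∈ E ↔ ∀ q ∈ T, q v = 0 := by
  rw [zariskiProjPow, isClosed_coinduced, @isClosed_induced_iff _ _ (zariski (Fin n → V))] at hE
  obtain ⟨Z, hZ, hE⟩ := hE
  obtain ⟨T, hT, rfl⟩ := isClosed_zariski_iff.1 hZ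
  exact ⟨T, hT, fun v hv => (Set.ext_iff.1 hE ⟨v, hv⟩).symm⟩

/-- The ideal of the affine cone over a subset of `ℙ(V)`. -/
noncomputable def coneIdeal (S : Set (ℙ ℂ V)) : Ideal (polyFun V) where
  carrier := {q | ∀ v (hv : v ≠ 0), Projectivization.mk ℂ v hv ∈ S → q.1 v = 0}
  add_mem' hp hq v hv h := by
    change _ + _ = (0 : ℂ)
    rw [hp v hv h, hq v hv h, add_zero]
  zero_mem' v hv h := rfl
  smul_mem' c q hq v hv h := by
    change _ * _ = (0 : ℂ)
    rw [hq v hv h, mul_zero]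

theorem coneIdeal_anti {S T : Set (ℙ ℂ V)} (h : S ⊆ T) : coneIdeal T ≤ coneIdeal S :=
  fun _ hq v hv hvS => hq v hv (h hvS)

/-- Members of the ideal need not be homogeneous, so their zero sets need not be cones. The remedy
is `E r`, the points whose whole punctured line is killed by `r`; it is closed, being cut out by all
rescalings of `r`. On a line of the cone a product of two one-variable polynomials vanishes, so one
factor does, and irreducibility applies to `E p ∪ E q`. -/
theorem coneIdeal_isPrime {S : Set (ℙ ℂ V)} (hS : @IsIrreducible _ (zariskiProj V) S) :
    (coneIdeal S).IsPrime := by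
  refine ⟨?_, ?_⟩
  · rw [Ideal.ne_top_iff_one]
    intro h
    obtain ⟨x, hx⟩ := hS.1
    induction x using Projectivization.ind with
    | h v hv => exact one_ne_zero (h v hv hx)
  · intro p q hpq
    let E : polyFun V → Set (ℙ ℂ V) := fun r => {x | ∀ v (hv : v ≠ 0),
      Projectivization.mk ℂ v hv = x → r.1 v = 0}
    have hE : ∀ (r : polyFun V) v (hv : v ≠ 0), Projectivization.mk ℂ v hv ∈ E r ↔
        ∀ c : ℂˣ, r.1 (c.1 • v) = 0 := by
      intro r v hv
      constructor
      · intro h c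
        refine h _ (smul_ne_zero c.ne_zero hv) ?_
        rw [Projectivization.mk_eq_mk_iff]
        exact ⟨c, rfl⟩
      · intro h w hw hwv
        rw [Projectivization.mk_eq_mk_iff] at hwv
        obtain ⟨c, rfl⟩ := hwv
        exact h c
    have hcl : ∀ r, IsClosed[zariskiProj V] (E r) := fun r =>
      isClosed_zariskiProj (q := fun (c : ℂˣ) v => r.1 (c.1 • v))
        (fun c => (isPolyMap_linear (c.1 • LinearMap.id)).comp_mem r.2) (hE r)
    have hsub : S ⊆ E p ∪ E q := by
      intro x hx
      induction x using Projectivization.ind with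
      | h v hv =>
        rw [Set.mem_union, hE, hE]
        obtain ⟨p', hp'⟩ := exists_polynomial_line p.2 0 v
        obtain ⟨q', hq'⟩ := exists_polynomial_line q.2 0 v
        -- The factor `X` covers `s = 0`, where the hypothesis says nothing.
        have h0 : Polynomial.X * (p' * q') = 0 := by
          refine Polynomial.funext fun s => ?_
          by_cases hs : s = 0
          · simp [hs]
          · have h1 := hpq (s • v) (smul_ne_zero hs hv) (by
              rwa [show Projectivization.mk ℂ (s • v) (smul_ne_zero hs hv) =
                Projectivization.mk ℂ v hv from
                (Projectivization.mk_eq_mk_iff ..).2 ⟨Units.mk0 s hs, rfl⟩])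
            have h2 : p'.eval s * q'.eval s = 0 := by
              rw [hp', hq', zero_add]; exact h1
            simp [Polynomial.eval_mul, h2]
        rcases mul_eq_zero.1 ((mul_eq_zero.1 h0).resolve_left Polynomial.X_ne_zero) with h | h
        · left
          intro c
          simpa [h] using (hp' c).symm
        · right
          intro c
          simpa [h] using (hq' c).symm
    rcases @isPreirreducible_iff_isClosed_union_isClosed _ (zariskiProj V) S |>.1 hS.2 _ _
      (hcl p) (hcl q) hsub with h | h
    · exact Or.inl fun v hv hvS => h hvS v hv rfl
    · exact Or.inr fun v hv hvS => h hvS v hv rfl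

theorem exists_mem_coneIdeal_sdiff {S T : Set (ℙ ℂ V)}
    (h : ¬ T ⊆ @closure _ (zariskiProj V) S) : ∃ q, q ∈ coneIdeal S ∧ q ∉ coneIdeal T := by
  obtain ⟨x, hxT, hx⟩ := Set.not_subset.1 h
  obtain ⟨Q, hQ, hE⟩ := exists_of_isClosed_zariskiProj
    (@isClosed_closure _ (zariskiProj V) S)
  induction x using Projectivization.ind with
  | h v hv =>
    rw [hE] at hx
    push Not at hx
    obtain ⟨q, hqQ, hqv⟩ := hx
    refine ⟨⟨q, hQ hqQ⟩, fun w hw hwS => ?_, fun h => hqv (h v hv hxT)⟩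
    exact (hE w hw).1 (@subset_closure _ (zariskiProj V) S _ hwS) q hqQ

theorem withBot_enat_le_natCast {a : WithBot ℕ∞} {m : ℕ}
    (h : ∀ n : ℕ, (n : WithBot ℕ∞) ≤ a → n ≤ m) : a ≤ m := by
  induction a using WithBot.recBotCoe with
  | bot => exact bot_le
  | coe a =>
    induction a using ENat.recTopCoe with
    | top =>
      have := h (m + 1) (WithBot.coe_le_coe.2 le_top)
      omega
    | coe n => exact_mod_cast h n le_rfl

/-- The coordinates make this algebra a quotient of the polynomial ring in `m` variables, and
quotients do not raise transcendence degree. -/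
theorem trdeg_polyFun_le (m : ℕ) : Algebra.trdeg ℂ (polyFun (Fin m → ℂ)) ≤ m := by
  let c : Fin m → polyFun (Fin m → ℂ) := fun i =>
    ⟨fun t => t i, dual_mem_polyFun (V := Fin m → ℂ) (LinearMap.proj i)⟩
  have hsurj : Function.Surjective (MvPolynomial.aeval c : MvPolynomial (Fin m) ℂ →ₐ[ℂ] _) := by
    rintro ⟨q, hq⟩
    rw [polyFun_pi_eq_adjoin, Algebra.adjoin_range_eq_range_aeval] at hq
    obtain ⟨P, hP⟩ := hq
    refine ⟨P, Subtype.ext ?_⟩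
    refine Eq.trans ?_ hP
    change (polyFun (Fin m → ℂ)).val _ = _
    rw [MvPolynomial.comp_aeval_apply]
    rfl
  have := trdeg_le_of_surjective _ hsurj
  rwa [MvPolynomial.trdeg_of_isDomain, Cardinal.mk_fin, Cardinal.lift_natCast] at this

/-- A subset of `ℙ(V)` whose cone is contained in the closure of the image of a polynomial map in
`m + 1` parameters has dimension at most `m`. -/
theorem dimProj_le [FiniteDimensional ℂ W] {m : ℕ} (hW : Module.finrank ℂ W = m + 1)
    {Z : Set (ℙ ℂ V)} {Φ : W → V} (hΦ : IsPolyMap Φ)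
    (hZ : ∀ q ∈ polyFun V, (∀ t, q (Φ t) = 0) →
      ∀ v (hv : v ≠ 0), Projectivization.mk ℂ v hv ∈ Z → q v = 0) :
    dimProj Z ≤ m := by
  refine withBot_enat_le_natCast fun n hn => ?_
  let _ : TopologicalSpace (ℙ ℂ V) := zariskiProj V
  obtain ⟨S, hS, hS'⟩ := le_topologicalKrullDim_subtype_iff.1 hn
  let e : (Fin (m + 1) → ℂ) ≃ₗ[ℂ] W :=
    (LinearEquiv.ofFinrankEq _ _ (by rw [hW, Module.finrank_fin_fun]))
  have hΦ' : IsPolyMap fun t => Φ (e t) := hΦ.comp (isPolyMap_linear e.toLinearMap)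
  -- The ideal of the vertex of the cone is appended as one more prime. This extra step makes a
  -- chain of length `n` in `Z` produce `n + 1` independent functions, matching the `m + 1`
  -- parameters. The index is reversed because larger sets have smaller ideals.
  let ev0 : polyFun V →+* ℂ := (Pi.evalRingHom (fun _ : V => ℂ) 0).comp (polyFun V).val.toRingHom
  let P : ℕ → Ideal (polyFun V) := fun i =>
    if i ≤ n then coneIdeal (S (n - i)) else RingHom.ker ev0
  have hP : ∀ i ≤ n, P i = coneIdeal (S (n - i)) := fun i hi => if_pos hi
  have hPn : P (n + 1) = RingHom.ker ev0 := if_neg (by omega)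
  have hprime : ∀ i ≤ n + 1, (P i).IsPrime := by
    intro i hi
    rcases Nat.le_succ_iff.1 hi with h | rfl
    · rw [hP i h]
      exact coneIdeal_isPrime (hS _ (Nat.sub_le _ _)).1
    · rw [hPn]
      exact RingHom.ker_isPrime _
  have hle : ∀ i < n + 1, P i ≤ P (i + 1) := by
    intro i hi
    rcases Nat.lt_succ_iff_lt_or_eq.1 hi with h | rfl
    · rw [hP i h.le, hP _ h]
      refine coneIdeal_anti ?_
      have := (hS' (n - (i + 1)) (by omega)).1
      rwa [show n - (i + 1) + 1 = n - i by omega] at this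
    · rw [hP i le_rfl, hPn]
      intro q hq
      obtain ⟨x, hx⟩ := (hS (i - i) (Nat.sub_le _ _)).1.1
      induction x using Projectivization.ind with
      | h v hv =>
        obtain ⟨q', hq'⟩ := exists_polynomial_line q.2 0 v
        have h0 : Polynomial.X * q' = 0 := by
          refine Polynomial.funext fun s => ?_
          by_cases hs : s = 0
          · simp [hs]
          · have h1 := hq (s • v) (smul_ne_zero hs hv) (by
              rwa [show Projectivization.mk ℂ (s • v) (smul_ne_zero hs hv) =
                Projectivization.mk ℂ v hv from
                (Projectivization.mk_eq_mk_iff ..).2 ⟨Units.mk0 s hs, rfl⟩])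
            simp [hq', h1]
        have h2 := (mul_eq_zero.1 h0).resolve_left Polynomial.X_ne_zero
        have h3 := hq' 0
        rw [h2] at h3
        rw [RingHom.mem_ker]
        simpa [ev0] using h3.symm
  have hx : ∀ i : ℕ, ∃ x : polyFun V, i < n + 1 → x ∈ P (i + 1) ∧ x ∉ P i := by
    intro i
    by_cases hi : i < n + 1
    · rcases Nat.lt_succ_iff_lt_or_eq.1 hi with h | rfl
      · rw [hP i h.le, hP _ h]
        have := (hS' (n - (i + 1)) (by omega)).2
        rw [show n - (i + 1) + 1 = n - i by omega] at this
        obtain ⟨q, hq⟩ := exists_mem_coneIdeal_sdiff this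
        exact ⟨q, fun _ => hq⟩
      · rw [hP i le_rfl, hPn]
        obtain ⟨x, hx⟩ := (hS (i - i) (Nat.sub_le _ _)).1.1
        induction x using Projectivization.ind with
        | h v hv =>
          obtain ⟨φ, hφ⟩ : ∃ φ : Module.Dual ℂ V, φ v ≠ 0 := by
            by_contra! hcon
            exact hv ((Module.forall_dual_apply_eq_zero_iff ℂ v).1 hcon)
          refine ⟨⟨φ, dual_mem_polyFun φ⟩, fun _ => ⟨?_, fun h => hφ (h v hv hx)⟩⟩
          rw [RingHom.mem_ker]
          exact map_zero φ
    · exact ⟨0, fun h => absurd h hi⟩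
  choose x hx using hx
  -- A relation between the pullbacks is a function vanishing along `Φ`, hence on the cone over `Z`,
  -- hence lying in `P 0`; this is excluded by the chain of primes.
  have hind : AlgebraicIndependent ℂ fun i : Fin (n + 1) => hΦ'.pullback (x i) := by
    rw [algebraicIndependent_iff]
    intro f hf
    by_contra hf0
    apply aeval_notMem_of_prime_chain (n + 1) P x hprime hle hx f hf0
    rw [hP 0 (Nat.zero_le _)]
    intro v hv hvS
    have hcomp : hΦ'.pullback (MvPolynomial.aeval (fun i : Fin (n + 1) => x i) f) = 0 := by
      rw [← hf, ← MvPolynomial.comp_aeval_apply]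
    refine hZ _ (Subtype.property _) (fun t => ?_) v hv ((hS _ (Nat.sub_le _ _)).2 hvS)
    have := congrFun (congrArg Subtype.val hcomp) (e.symm t)
    rw [← e.apply_symm_apply t]
    exact this
  have h1 := hind.cardinalMk_le_trdeg.trans (trdeg_polyFun_le (m + 1))
  rw [Cardinal.mk_fin] at h1
  have : n + 1 ≤ m + 1 := by exact_mod_cast h1
  omega

end ProjClosed

/-! ### Linear forms, their products, and polynomial dependence on coefficients -/

section Forms

variable {V W : Type*} [AddCommGroup V] [Module ℂ V] [AddCommGroup W] [Module ℂ W]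

/-- Evaluation of forms at a point. -/
noncomputable def evalAt {d : ℕ} (p : Fin 3 → ℂ) : Form d →ₗ[ℂ] ℂ where
  toFun F := MvPolynomial.eval p F.1
  map_add' F G := by simp
  map_smul' c F := by simp [MvPolynomial.smul_eq_C_mul]

theorem evalAt_apply {d : ℕ} (p : Fin 3 → ℂ) (F : Form d) :
    evalAt p F = MvPolynomial.eval p F.1 := rfl

/-- The linear form with given coefficients. -/
noncomputable def lin : (Fin 3 → ℂ) →ₗ[ℂ] Form 1 where
  toFun r := ⟨∑ j, MvPolynomial.C (r j) * MvPolynomial.X j,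
    MvPolynomial.IsHomogeneous.sum _ _ _ fun _ _ => MvPolynomial.isHomogeneous_C_mul_X _ _⟩
  map_add' r s := Subtype.ext (by simp [add_mul, Finset.sum_add_distrib])
  map_smul' c r := Subtype.ext (by simp [MvPolynomial.smul_eq_C_mul, Finset.mul_sum, mul_assoc])

theorem coe_lin (r : Fin 3 → ℂ) :
    (lin r).1 = ∑ j, MvPolynomial.C (r j) * MvPolynomial.X j := rfl

theorem evalAt_lin (p r : Fin 3 → ℂ) : evalAt p (lin r) = r ⬝ᵥ p := by
  simp [evalAt_apply, coe_lin, dotProduct]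

theorem lin_injective : Function.Injective lin := by
  intro r s h
  ext j
  have := congrArg (evalAt (Pi.single j 1)) h
  simpa [evalAt_lin] using this

theorem lin_ne_zero {r : Fin 3 → ℂ} (hr : r ≠ 0) : lin r ≠ 0 :=
  fun h => hr (lin_injective (by rw [h, map_zero]))

theorem lin_surjective : Function.Surjective lin := by
  intro F
  refine ⟨fun j => MvPolynomial.coeff (Finsupp.single j 1) F.1, Subtype.ext ?_⟩
  rw [coe_lin]
  ext m
  by_cases hm : m.degree = 1
  · obtain ⟨a, rfl⟩ := (Finsupp.sum_eq_one_iff m).1 hm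
    simp only [MvPolynomial.coeff_sum, MvPolynomial.coeff_C_mul, MvPolynomial.coeff_X,
      Finsupp.single_left_inj one_ne_zero]
    simp
  · rw [F.2.coeff_eq_zero hm]
    refine MvPolynomial.IsHomogeneous.coeff_eq_zero (n := 1) ?_ hm
    exact MvPolynomial.IsHomogeneous.sum _ _ _ fun _ _ => MvPolynomial.isHomogeneous_C_mul_X _ _

theorem subst_lin (M : Matrix (Fin 3) (Fin 3) ℂ) (r : Fin 3 → ℂ) :
    subst M (lin r).1 = (lin (Matrix.vecMul r M)).1 := by
  simp only [coe_lin, subst, map_sum, map_mul, MvPolynomial.aeval_X, MvPolynomial.algHom_C,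
    MvPolynomial.algebraMap_eq, Matrix.vecMul, dotProduct, Finset.mul_sum, Finset.sum_mul]
  rw [Finset.sum_comm]
  simp [mul_assoc]

theorem smul_lin (g : GL (Fin 3) ℂ) (r : Fin 3 → ℂ) :
    g • lin r = lin (Matrix.vecMul r (g⁻¹ : GL (Fin 3) ℂ).1) :=
  Subtype.ext (by rw [coe_smul_form, subst_lin])

theorem vecMul_ne_zero (N : GL (Fin 3) ℂ) {r : Fin 3 → ℂ} (hr : r ≠ 0) :
    Matrix.vecMul r N.1 ≠ 0 := by
  intro h
  apply hr
  have := congrArg (fun v => Matrix.vecMul v (N⁻¹ : GL (Fin 3) ℂ).1) h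
  simpa [Matrix.vecMul_vecMul, ← Units.val_mul] using this

/-- A map to the space of forms is polynomial if its coefficients are. -/
theorem isPolyMap_form {d : ℕ} {f : W → Form d}
    (hf : ∀ m, IsPolyMap fun w => MvPolynomial.coeff m (f w).1) : IsPolyMap f := by
  classical
  let s : Finset (Fin 3 →₀ ℕ) := Finset.finsuppAntidiag Finset.univ d
  let b : s → Form d := fun m => ⟨MvPolynomial.monomial m.1 1, by
    refine MvPolynomial.isHomogeneous_monomial _ ?_
    have := (Finset.mem_finsuppAntidiag.1 m.2).1
    rw [Finsupp.degree_eq_sum]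
    exact this⟩
  have hfb : ∀ w, f w = ∑ m : s, MvPolynomial.coeff m.1 (f w).1 • b m := by
    intro w
    refine Subtype.ext ?_
    have hb : ∀ (c : ℂ) (m : s), (c • b m).1 = MvPolynomial.monomial m.1 c := fun c m => by
      change c • MvPolynomial.monomial m.1 1 = _
      rw [MvPolynomial.smul_monomial, smul_eq_mul, mul_one]
    rw [AddSubmonoidClass.coe_finsetSum, Finset.sum_congr rfl fun m _ => hb _ m]
    rw [Finset.sum_coe_sort s fun m => MvPolynomial.monomial m (MvPolynomial.coeff m (f w).1)]
    conv_lhs => rw [(f w).1.as_sum]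
    refine Finset.sum_subset (fun m hm => ?_) (fun m _ hm => ?_)
    · refine Finset.mem_finsuppAntidiag.2 ⟨?_, Finset.subset_univ _⟩
      have hd : m.degree = d := by
        by_contra hne
        exact (MvPolynomial.mem_support_iff.1 hm) ((f w).2.coeff_eq_zero hne)
      rw [← hd, Finsupp.degree_eq_sum]
    · rw [MvPolynomial.notMem_support_iff.1 hm, MvPolynomial.monomial_zero]
  have : f = fun w => ∑ m : s, MvPolynomial.coeff m.1 (f w).1 • b m := funext hfb
  rw [this]
  exact IsPolyMap.sum fun m => (hf m.1).smul (isPolyMap_const _)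

theorem isPolyMap_coeff {d : ℕ} {f : W → Form d} (hf : IsPolyMap f) (m : Fin 3 →₀ ℕ) :
    IsPolyMap fun w => MvPolynomial.coeff m (f w).1 :=
  (isPolyMap_linear ((MvPolynomial.lcoeff ℂ m).comp (Submodule.subtype _) : Form d →ₗ[ℂ] ℂ)).comp hf

theorem isPolyMap_coeff_prod {ι : Type*} (s : Finset ι) {f : ι → W → MvPolynomial (Fin 3) ℂ}
    (hf : ∀ i m, IsPolyMap fun w => MvPolynomial.coeff m (f i w)) (m : Fin 3 →₀ ℕ) :
    IsPolyMap fun w => MvPolynomial.coeff m (∏ i ∈ s, f i w) := by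
  classical
  induction s using Finset.induction_on generalizing m with
  | empty => simp only [Finset.prod_empty]; fun_prop
  | insert a s ha ih =>
    simp only [Finset.prod_insert ha, MvPolynomial.coeff_mul]
    exact IsPolyMap.sum fun x => (hf a _).mul (ih _)

theorem isPolyMap_prodForm {d : ℕ} : IsPolyMap (prodForm : (Fin d → Form 1) → Form d) :=
  isPolyMap_form fun m => isPolyMap_coeff_prod _ (fun i m =>
    isPolyMap_coeff (isPolyMap_apply i) m) m

@[fun_prop]
theorem IsPolyMap.lin {f : W → Fin 3 → ℂ} (hf : IsPolyMap f) : IsPolyMap fun w => lin (f w) :=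
  (isPolyMap_linear LineArrangement.lin).comp hf

@[fun_prop]
theorem IsPolyMap.prodForm {d : ℕ} {f : W → Fin d → Form 1} (hf : IsPolyMap f) :
    IsPolyMap fun w => prodForm (f w) :=
  isPolyMap_prodForm.comp hf

theorem evalAt_prodForm {d : ℕ} (p : Fin 3 → ℂ) (v : Fin d → Form 1) :
    evalAt p (prodForm v) = ∏ i, evalAt p (v i) := by
  simp [evalAt_apply, LineArrangement.prodForm]

theorem prodForm_smul {d : ℕ} (c : Fin d → ℂ) (v : Fin d → Form 1) :
    prodForm (fun i => c i • v i) = (∏ i, c i) • prodForm v := by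
  refine Subtype.ext ?_
  change ∏ i, (c i • (v i).1) = (∏ i, c i) • ∏ i, (v i).1
  simp only [MvPolynomial.smul_eq_C_mul, Finset.prod_mul_distrib, map_prod]

end Forms

/-! ### Orbits -/

section Orbits

variable {d : ℕ} {r : Fin d → Fin 3 → ℂ} (hr : ∀ i, r i ≠ 0)

/-- The tuple of lines with given coefficient vectors. -/
noncomputable def lines (r : Fin d → Fin 3 → ℂ) (hr : ∀ i, r i ≠ 0) : Fin d → ℙ ℂ (Form 1) :=
  fun i => Projectivization.mk ℂ (lin (r i)) (lin_ne_zero (hr i))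

theorem lines_congr {r s : Fin d → Fin 3 → ℂ} (hr : ∀ i, r i ≠ 0) (hs : ∀ i, s i ≠ 0)
    (h : r = s) : lines r hr = lines s hs := by
  subst h; rfl

theorem exists_eq_lines (l : Fin d → ℙ ℂ (Form 1)) : ∃ r hr, l = lines r hr := by
  choose r h using fun i => lin_surjective (l i).rep
  have hr : ∀ i, r i ≠ 0 := fun i h0 => (l i).rep_nonzero (by rw [← h i, h0, map_zero])
  refine ⟨r, hr, funext fun i => ?_⟩
  simp only [lines, h, Projectivization.mk_rep]

theorem mk_smul_lines (g : GL (Fin 3) ℂ) :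
    (Matrix.ProjGenLinGroup.mk g : PGL(3, ℂ)) • lines r hr =
      lines (fun i => Matrix.vecMul (r i) (g⁻¹ : GL (Fin 3) ℂ).1)
        (fun i => vecMul_ne_zero _ (hr i)) := by
  funext i
  change g • Projectivization.mk ℂ (lin (r i)) _ = _
  simp only [Projectivization.smul_mk, smul_lin, lines]

theorem mem_orbit_lines {x : Fin d → ℙ ℂ (Form 1)} :
    x ∈ MulAction.orbit PGL(3, ℂ) (lines r hr) ↔
      ∃ N : GL (Fin 3) ℂ, x = lines (fun i => Matrix.vecMul (r i) N.1)
        (fun i => vecMul_ne_zero N (hr i)) := by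
  constructor
  · rintro ⟨g, rfl⟩
    induction g using Matrix.ProjGenLinGroup.induction_on with
    | mk g => exact ⟨g⁻¹, mk_smul_lines hr g⟩
  · rintro ⟨N, rfl⟩
    refine ⟨Matrix.ProjGenLinGroup.mk N⁻¹, ?_⟩
    refine (mk_smul_lines hr _).trans (lines_congr _ _ ?_)
    rw [inv_inv]

theorem psi_lines : psi (lines r hr) =
    Projectivization.mk ℂ (prodForm fun i => lin (r i))
      (prodForm_ne_zero fun i => lin_ne_zero (hr i)) :=
  psi_mk _ _

/-- Substitution is an algebra homomorphism, so it commutes with products; hence `psi` carries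
orbits onto orbits. -/
theorem smul_psi (g : PGL(3, ℂ)) (l : Fin d → ℙ ℂ (Form 1)) : g • psi l = psi (g • l) := by
  obtain ⟨r, hr, rfl⟩ := exists_eq_lines l
  induction g using Matrix.ProjGenLinGroup.induction_on with
  | mk g =>
    rw [mk_smul_lines, psi_lines, psi_lines]
    change g • Projectivization.mk ℂ (prodForm _) _ = _
    rw [Projectivization.smul_mk]
    congr 1
    refine Subtype.ext ?_
    rw [coe_smul_form]
    change subst _ (∏ i : Fin d, _) = ∏ i : Fin d, _
    rw [map_prod]
    exact Finset.prod_congr rfl fun i _ => subst_lin _ _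

theorem orbit_psi (l : Fin d → ℙ ℂ (Form 1)) :
    MulAction.orbit PGL(3, ℂ) (psi l) = psi '' MulAction.orbit PGL(3, ℂ) l := by
  ext x
  constructor
  · rintro ⟨g, rfl⟩
    exact ⟨g • l, ⟨g, rfl⟩, (smul_psi g l).symm⟩
  · rintro ⟨_, ⟨g, rfl⟩, rfl⟩
    exact ⟨g, smul_psi g l⟩

/-- Equations of the members of the orbit of a product of lines. -/
theorem exists_of_mk_mem_orbit {v : Form d} {hv : v ≠ 0}
    (h : Projectivization.mk ℂ v hv ∈ MulAction.orbit PGL(3, ℂ) (psi (lines r hr))) :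
    ∃ (c : ℂ) (N : GL (Fin 3) ℂ), v = c • prodForm fun i => lin (Matrix.vecMul (r i) N.1) := by
  rw [orbit_psi] at h
  obtain ⟨x, hx, hxv⟩ := h
  obtain ⟨N, rfl⟩ := (mem_orbit_lines hr).1 hx
  rw [psi_lines, eq_comm, Projectivization.mk_eq_mk_iff] at hxv
  obtain ⟨c, hc⟩ := hxv
  exact ⟨c, N, hc.symm⟩

end Orbits

/-! ### Lower bounds -/

section LowerBound

variable {V W : Type*} [AddCommGroup V] [Module ℂ V] [AddCommGroup W] [Module ℂ W]

/-- The image of a principal open set in a product of projective spaces, under a map given by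
polynomials, is irreducible. -/
theorem isIrreducible_param {n : ℕ} {h : W → ℂ} (hh : IsPolyMap h) (h0 : ∃ t, h t ≠ 0)
    {v : W → Fin n → V} (hv : IsPolyMap v) (hv0 : ∀ t, h t ≠ 0 → ∀ j, v t j ≠ 0) :
    @IsIrreducible _ (zariskiProjPow V n)
      {x | ∃ t, ∃ ht : h t ≠ 0, x = fun j => Projectivization.mk ℂ (v t j) (hv0 t ht j)} := by
  let _ := zariskiProjPow V n
  obtain ⟨t₀, ht₀⟩ := h0
  refine ⟨⟨_, t₀, ht₀, rfl⟩, isPreirreducible_iff_isClosed_union_isClosed.2 ?_⟩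
  intro Z₁ Z₂ hZ₁ hZ₂ hsub
  obtain ⟨T₁, hT₁, hE₁⟩ := exists_of_isClosed_zariskiProjPow hZ₁
  obtain ⟨T₂, hT₂, hE₂⟩ := exists_of_isClosed_zariskiProjPow hZ₂
  by_contra! hcon
  simp only [Set.not_subset] at hcon
  obtain ⟨⟨x, ⟨t, ht, rfl⟩, hx⟩, y, ⟨u, hu, rfl⟩, hy⟩ := hcon
  rw [hE₁] at hx
  rw [hE₂] at hy
  push Not at hx hy
  obtain ⟨p, hp, hpt⟩ := hx
  obtain ⟨q, hq, hqu⟩ := hy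
  have hp' := hv.comp_mem (hT₁ hp)
  have hq' := hv.comp_mem (hT₂ hq)
  -- One parameter in the open set at which both separating functions are nonzero gives a point in
  -- neither closed set.
  obtain ⟨w, hw⟩ := polyFun_mul_ne_zero (isPolyMap_complex.1 hh) (mul_mem hp' hq') ⟨t₀, ht₀⟩
    (polyFun_mul_ne_zero hp' hq' ⟨t, hpt⟩ ⟨u, hqu⟩)
  simp only [Pi.mul_apply, ne_eq, mul_eq_zero, not_or] at hw
  rcases hsub ⟨w, hw.1, rfl⟩ with h' | h'
  · exact hw.2.1 ((hE₁ _ _).1 h' p hp)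
  · exact hw.2.2 ((hE₂ _ _).1 h' q hq)

/-- A multihomogeneous condition defines a closed subset of a product of projective spaces. -/
theorem exists_isClosed_of_forall_smul {n : ℕ} {q : (Fin n → V) → ℂ} (hq : IsPolyMap q)
    (hc : ∀ (c : Fin n → ℂˣ) v, q v = 0 → q (fun j => (c j : ℂ) • v j) = 0) :
    ∃ E : Set (Fin n → ℙ ℂ V), IsClosed[zariskiProjPow V n] E ∧
      ∀ (v : Fin n → V) (hv : ∀ j, v j ≠ 0),
        (fun j => Projectivization.mk ℂ (v j) (hv j)) ∈ E ↔ q v = 0 := by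
  let E : Set (Fin n → ℙ ℂ V) := {x | ∀ (v : Fin n → V) (hv : ∀ j, v j ≠ 0),
    (fun j => Projectivization.mk ℂ (v j) (hv j)) = x → q v = 0}
  have hE : ∀ (v : Fin n → V) (hv : ∀ j, v j ≠ 0),
      (fun j => Projectivization.mk ℂ (v j) (hv j)) ∈ E ↔ q v = 0 := by
    refine fun v hv => ⟨fun h => h v hv rfl, fun h w hw hwv => ?_⟩
    choose c hc' using fun j => (Projectivization.mk_eq_mk_iff ..).1 (congrFun hwv j)
    have := hc c v h
    convert! this using 2
    exact funext fun j => (hc' j).symm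
  exact ⟨E, isClosed_zariskiProjPow (ι := Unit) (q := fun _ => q)
    (fun _ => isPolyMap_complex.1 hq) (fun v hv => by rw [hE]; simp), hE⟩

@[fun_prop]
theorem IsPolyMap.vecMul {f : W → Matrix (Fin 3) (Fin 3) ℂ}
    (hf : ∀ i j, IsPolyMap fun w => f w i j) (r : Fin 3 → ℂ) :
    IsPolyMap fun w => Matrix.vecMul r (f w) := by
  refine isPolyMap_pi fun j => ?_
  simp only [Matrix.vecMul, dotProduct]
  fun_prop

theorem IsPolyMap.det {f : W → Matrix (Fin 3) (Fin 3) ℂ}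
    (hf : ∀ i j, IsPolyMap fun w => f w i j) : IsPolyMap fun w => (f w).det := by
  simp only [Matrix.det_fin_three]
  fun_prop

/-- By `h`, the parameter `t j` is an affine coordinate (an entry divided by the last one) of the
line `idx j` moved by `M t`. Freezing all coordinates from index `m` on at `t₀` gives irreducible
sets `S m` inside the orbit. On `S m` coordinate `m` is constant, a closed condition, while on `S (m
+ 1)` it varies, so the `k + 1` sets form a strict chain. -/
theorem le_dimProjPow_orbit {d k : ℕ} {r : Fin d → Fin 3 → ℂ} (hr : ∀ i, r i ≠ 0)
    (M : (Fin k → ℂ) → Matrix (Fin 3) (Fin 3) ℂ) (hM : ∀ a b, IsPolyMap fun t => M t a b)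
    (idx : Fin k → Fin d) (col : Fin k → Fin 3)
    (h : ∀ t j, Matrix.vecMul (r (idx j)) (M t) (col j) =
      t j * Matrix.vecMul (r (idx j)) (M t) 2)
    (t₀ : Fin k → ℂ) (hdet : (M t₀).det ≠ 0)
    (h2 : ∀ j, Matrix.vecMul (r (idx j)) (M t₀) 2 ≠ 0) :
    (k : WithBot ℕ∞) ≤ dimProjPow (MulAction.orbit PGL(3, ℂ) (lines r hr)) := by
  let _ := zariskiProjPow (Form 1) d
  refine le_topologicalKrullDim_subtype_iff.2 ?_
  let τ : ℕ → (Fin k → ℂ) → Fin k → ℂ := fun m t j => if (j : ℕ) < m then t j else t₀ j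
  have hτ : ∀ m, IsPolyMap (τ m) := fun m => isPolyMap_pi fun j => by
    by_cases hj : (j : ℕ) < m
    · simp only [τ, if_pos hj]; fun_prop
    · simp only [τ, if_neg hj]; fun_prop
  have hτ0 : ∀ m, τ m t₀ = t₀ := fun m => funext fun j => by simp [τ]
  have hMτ : ∀ m a b, IsPolyMap fun t => M (τ m t) a b := fun m a b => (hM a b).comp (hτ m)
  -- Nonvanishing of `g` means that the matrix is invertible and that every affine coordinate used
  -- is defined.
  let g : ℕ → (Fin k → ℂ) → ℂ := fun m t =>
    (M (τ m t)).det * ∏ j, Matrix.vecMul (r (idx j)) (M (τ m t)) 2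
  have hg : ∀ m, IsPolyMap (g m) := fun m => by
    have h1 := IsPolyMap.det (hMτ m)
    have h3 := fun i => IsPolyMap.vecMul (hMτ m) (r i)
    fun_prop
  have hg0 : ∀ m, g m t₀ ≠ 0 := fun m => by
    simp only [g, hτ0]
    exact mul_ne_zero hdet (Finset.prod_ne_zero_iff.2 fun j _ => h2 j)
  let v : ℕ → (Fin k → ℂ) → Fin d → Form 1 := fun m t i => lin (Matrix.vecMul (r i) (M (τ m t)))
  have hv : ∀ m, IsPolyMap (v m) := fun m => by
    have h3 := fun i => IsPolyMap.vecMul (hMτ m) (r i)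
    fun_prop
  have hv0 : ∀ m t, g m t ≠ 0 → ∀ i, v m t i ≠ 0 := fun m t ht i =>
    lin_ne_zero (vecMul_ne_zero
      (Matrix.GeneralLinearGroup.mkOfDetNeZero _ (left_ne_zero_of_mul ht)) (hr i))
  let S : ℕ → Set (Fin d → ℙ ℂ (Form 1)) := fun m =>
    {x | ∃ t, ∃ ht : g m t ≠ 0, x = fun j => Projectivization.mk ℂ (v m t j) (hv0 m t ht j)}
  refine ⟨S, fun m _ => ⟨isIrreducible_param (hg m) ⟨t₀, hg0 m⟩ (hv m) (hv0 m), ?_⟩,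
    fun m hm => ⟨?_, fun hsub => ?_⟩⟩
  · rintro _ ⟨t, ht, rfl⟩
    exact (mem_orbit_lines hr).2
      ⟨Matrix.GeneralLinearGroup.mkOfDetNeZero _ (left_ne_zero_of_mul ht), rfl⟩
  · rintro _ ⟨t, ht, rfl⟩
    have hττ : τ (m + 1) (τ m t) = τ m t := funext fun j => by
      simp only [τ]
      split_ifs <;> first | rfl | omega
    refine ⟨τ m t, ?_, ?_⟩
    · simp only [g, hττ]; exact ht
    · simp only [v, hττ]
  · let j : Fin k := ⟨m, hm⟩
    -- The cleared form of "coordinate `j` equals `t₀ j`"; it is homogeneous in the single line `idx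
    -- j`.
    let q : (Fin d → Form 1) → ℂ := fun v =>
      evalAt (Pi.single (col j) 1) (v (idx j)) - t₀ j * evalAt (Pi.single 2 1) (v (idx j))
    have hq : IsPolyMap q := by
      have h1 := fun p : Fin 3 → ℂ => isPolyMap_linear (evalAt p : Form 1 →ₗ[ℂ] ℂ)
      have h3 : ∀ p : Fin 3 → ℂ, IsPolyMap fun v : Fin d → Form 1 => evalAt p (v (idx j)) :=
        fun p => (h1 p).comp (isPolyMap_apply (idx j))
      have h4 := h3 (Pi.single (col j) 1)
      have h5 := h3 (Pi.single 2 1)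
      fun_prop
    obtain ⟨E, hE, hEq⟩ := exists_isClosed_of_forall_smul hq (fun c v hv => by
      simp only [q, map_smul, smul_eq_mul] at hv ⊢
      linear_combination (c (idx j) : ℂ) * hv)
    have hval : ∀ m' t, q (v m' t) =
        (τ m' t j - t₀ j) * Matrix.vecMul (r (idx j)) (M (τ m' t)) 2 := by
      intro m' t
      simp only [q, v, evalAt_lin, dotProduct_single, mul_one, h, sub_mul]
    have hSE : S m ⊆ E := by
      rintro _ ⟨t, ht, rfl⟩
      rw [hEq, hval]
      simp [τ, j]
    have hSE' := hsub.trans (closure_minimal hSE hE)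
    have hlin : IsPolyMap fun t : Fin k → ℂ => t j - t₀ j := by fun_prop
    obtain ⟨t, ht⟩ := polyFun_mul_ne_zero (isPolyMap_complex.1 (hg (m + 1)))
      (isPolyMap_complex.1 hlin) ⟨t₀, hg0 _⟩ ⟨fun _ => t₀ j + 1, by simp⟩
    have ht1 := left_ne_zero_of_mul ht
    have h3 := (hEq _ _).1 (hSE' ⟨t, ht1, rfl⟩)
    rw [hval] at h3
    rcases mul_eq_zero.1 h3 with h4 | h4
    · refine right_ne_zero_of_mul ht ?_
      simpa [τ, j] using h4
    · exact Finset.prod_ne_zero_iff.1 (right_ne_zero_of_mul ht1) j (Finset.mem_univ _) h4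

end LowerBound

/-! ### Integrality modulo an ideal -/

/-- Integrality of an element modulo an ideal. -/
def IntegralMod {R A : Type*} [CommRing R] [CommRing A] (f : R →+* A) (I : Ideal A) (x : A) :
    Prop :=
  ∃ P : Polynomial R, P.Monic ∧ P.eval₂ f x ∈ I

section IntegralMod

variable {R A : Type*} [CommRing R] [CommRing A] {f : R →+* A} {I : Ideal A}

/-- Passing to the quotient ring makes closure under sums and products available from ordinary
integrality. -/
theorem integralMod_iff {x : A} : IntegralMod f I x ↔
    ((Ideal.Quotient.mk I).comp f).IsIntegralElem (Ideal.Quotient.mk I x) := by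
  simp only [IntegralMod, RingHom.IsIntegralElem, ← Polynomial.hom_eval₂,
    Ideal.Quotient.eq_zero_iff_mem]

theorem IntegralMod.add {x y : A} (hx : IntegralMod f I x) (hy : IntegralMod f I y) :
    IntegralMod f I (x + y) := by
  rw [integralMod_iff] at *
  rw [map_add]
  exact hx.add _ hy

theorem IntegralMod.mul {x y : A} (hx : IntegralMod f I x) (hy : IntegralMod f I y) :
    IntegralMod f I (x * y) := by
  rw [integralMod_iff] at *
  rw [map_mul]
  exact hx.mul _ hy

variable (f I) in
theorem IntegralMod.map (a : R) : IntegralMod f I (f a) :=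
  ⟨Polynomial.X - Polynomial.C a, Polynomial.monic_X_sub_C a, by simp⟩

end IntegralMod

/-! ### Affine charts of products of projective spaces -/

section Charts

variable {V : Type*} [AddCommGroup V] [Module ℂ V]

/-- Homogenization of polynomial functions with respect to a linear form. -/
theorem exists_homogenization {n : ℕ} (lam : V →ₗ[ℂ] ℂ) {q : (Fin n → V) → ℂ}
    (hq : q ∈ polyFun (Fin n → V)) :
    ∃ (N : ℕ) (q' : (Fin n → V) → ℂ), IsPolyMap q' ∧ ∀ v, (∀ i, lam (v i) ≠ 0) →
      q' v = (∏ i, lam (v i)) ^ N * q (fun i => (lam (v i))⁻¹ • v i) := by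
  classical
  have hlam : ∀ i, IsPolyMap fun v : Fin n → V => lam (v i) := fun i =>
    (isPolyMap_linear lam).comp (isPolyMap_apply i)
  have hpow : ∀ N : ℕ, IsPolyMap fun v : Fin n → V => (∏ i, lam (v i)) ^ N := fun N => by
    have h : IsPolyMap fun v : Fin n → V => ∏ i, lam (v i) :=
      IsPolyMap.prod hlam
    exact isPolyMap_complex.2 (pow_mem (isPolyMap_complex.1 h) N)
  induction hq using Algebra.adjoin_induction with
  | mem q hq =>
    obtain ⟨φ, rfl⟩ := hq
    -- Multiplying by the product of all `lam (v j)` cancels the denominator of component `i` and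
    -- leaves the other factors.
    refine ⟨1, fun v => φ fun i => (∏ j ∈ Finset.univ.erase i, lam (v j)) • v i, ?_,
      fun v hv => ?_⟩
    · have := isPolyMap_linear φ
      exact this.comp (isPolyMap_pi fun i =>
        (IsPolyMap.prod hlam).smul (isPolyMap_apply i))
    · rw [pow_one, ← smul_eq_mul, ← map_smul]
      refine congrArg φ ?_
      funext i
      rw [Pi.smul_apply, smul_smul, ← Finset.mul_prod_erase _ _ (Finset.mem_univ i)]
      congr 1
      field_simp [hv i]
  | algebraMap c => exact ⟨0, fun _ => c, isPolyMap_const c, fun v _ => by simp⟩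
  | add p q _ _ hp hq =>
    obtain ⟨N, p', hp', h1⟩ := hp
    obtain ⟨K, q', hq', h2⟩ := hq
    refine ⟨N + K, fun v => (∏ i, lam (v i)) ^ K * p' v + (∏ i, lam (v i)) ^ N * q' v,
      ((hpow K).mul hp').add ((hpow N).mul hq'), fun v hv => ?_⟩
    dsimp only
    rw [h1 v hv, h2 v hv, Pi.add_apply]
    ring
  | mul p q _ _ hp hq =>
    obtain ⟨N, p', hp', h1⟩ := hp
    obtain ⟨K, q', hq', h2⟩ := hq
    refine ⟨N + K, fun v => p' v * q' v, hp'.mul hq', fun v hv => ?_⟩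
    dsimp only
    rw [h1 v hv, h2 v hv, Pi.mul_apply]
    ring

/-- A polynomial condition in an affine chart extends to a closed condition in the product of
projective spaces. -/
theorem exists_isClosed_chart {n : ℕ} (lam : V →ₗ[ℂ] ℂ) {q : (Fin n → V) → ℂ}
    (hq : q ∈ polyFun (Fin n → V)) :
    ∃ E : Set (Fin n → ℙ ℂ V), IsClosed[zariskiProjPow V n] E ∧
      ∀ (v : Fin n → V) (hv : ∀ j, v j ≠ 0),
        (fun j => Projectivization.mk ℂ (v j) (hv j)) ∈ E ↔
          ((∀ i, lam (v i) ≠ 0) → q (fun i => (lam (v i))⁻¹ • v i) = 0) := by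
  obtain ⟨N, q', hq', h⟩ := exists_homogenization lam hq
  have hlam : ∀ i, IsPolyMap fun v : Fin n → V => lam (v i) := fun i =>
    (isPolyMap_linear lam).comp (isPolyMap_apply i)
  -- The additional factor puts everything outside the chart into the closed set, so the condition
  -- is vacuous there.
  have hiff : ∀ v : Fin n → V, (∏ i, lam (v i)) * q' v = 0 ↔
      ((∀ i, lam (v i) ≠ 0) → q (fun i => (lam (v i))⁻¹ • v i) = 0) := by
    intro v
    by_cases hv : ∀ i, lam (v i) ≠ 0
    · have h0 : ∏ i, lam (v i) ≠ 0 := Finset.prod_ne_zero_iff.2 fun i _ => hv i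
      simp [h v hv, hv, h0]
    · have h0 : ∏ i, lam (v i) = 0 := by
        by_contra h0
        exact hv fun i => Finset.prod_ne_zero_iff.1 h0 i (Finset.mem_univ i)
      simp [hv, h0]
  obtain ⟨E, hE, hEq⟩ := exists_isClosed_of_forall_smul
    (q := fun v => (∏ i, lam (v i)) * q' v) ((IsPolyMap.prod hlam).mul hq') (fun c v hv => by
      rw [hiff] at hv ⊢
      intro h1
      have h2 : ∀ i, lam (v i) ≠ 0 := fun i hi => h1 i (by simp [hi])
      rw [← hv h2]
      congr 1
      funext i
      rw [map_smul, smul_smul, smul_eq_mul, mul_inv, mul_right_comm,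
        inv_mul_cancel₀ (c i).ne_zero, one_mul])
  exact ⟨E, hE, fun v hv => by rw [hEq, hiff]⟩

theorem exists_isClosed_chart_single (lam : V →ₗ[ℂ] ℂ) {q : V → ℂ} (hq : q ∈ polyFun V) :
    ∃ E : Set (ℙ ℂ V), IsClosed[zariskiProj V] E ∧
      ∀ (v : V) (hv : v ≠ 0),
        Projectivization.mk ℂ v hv ∈ E ↔ (lam v ≠ 0 → q ((lam v)⁻¹ • v) = 0) := by
  obtain ⟨E, hE, hEq⟩ := exists_isClosed_chart (n := 1) lam
    ((isPolyMap_apply (V := V) (0 : Fin 1)).comp_mem hq)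
  obtain ⟨T, hT, hTq⟩ := exists_of_isClosed_zariskiProjPow hE
  have hmem : ∀ (v : V) (hv : v ≠ 0), Projectivization.mk ℂ v hv ∈
      (fun x (_ : Fin 1) => x) ⁻¹' E ↔ (lam v ≠ 0 → q ((lam v)⁻¹ • v) = 0) := by
    intro v hv
    have := hEq (fun _ => v) (fun _ => hv)
    simpa using this
  refine ⟨(fun x _ => x) ⁻¹' E, isClosed_zariskiProj (ι := T) (q := fun q v => q.1 fun _ => v)
    (fun q => ?_) fun v hv => ?_, hmem⟩
  · exact (isPolyMap_pi fun _ => IsPolyMap.id).comp_mem (hT q.2)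
  · have := hTq (fun _ => v) (fun _ => hv)
    simpa using this

/-- The ideal of a subset of a product of projective spaces in an affine chart. -/
noncomputable def chartIdeal {n : ℕ} (lam : V →ₗ[ℂ] ℂ) (S : Set (Fin n → ℙ ℂ V)) :
    Ideal (polyFun (Fin n → V)) where
  carrier := {q | ∀ (v : Fin n → V) (hv : ∀ i, v i ≠ 0), (∀ i, lam (v i) = 1) →
    (fun i => Projectivization.mk ℂ (v i) (hv i)) ∈ S → q.1 v = 0}
  add_mem' hp hq v hv h1 h := by
    change _ + _ = (0 : ℂ)
    rw [hp v hv h1 h, hq v hv h1 h, add_zero]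
  zero_mem' v hv h1 h := rfl
  smul_mem' c q hq v hv h1 h := by
    change _ * _ = (0 : ℂ)
    rw [hq v hv h1 h, mul_zero]

theorem mk_inv_smul {n : ℕ} (lam : V →ₗ[ℂ] ℂ) {v : Fin n → V} (hv : ∀ i, v i ≠ 0)
    (hl : ∀ i, lam (v i) ≠ 0) :
    (fun i => Projectivization.mk ℂ ((lam (v i))⁻¹ • v i)
      (smul_ne_zero (inv_ne_zero (hl i)) (hv i))) =
      fun i => Projectivization.mk ℂ (v i) (hv i) := by
  funext i
  rw [Projectivization.mk_eq_mk_iff]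
  exact ⟨(Units.mk0 _ (hl i))⁻¹, by simp [Units.smul_def]⟩

/-- The point `v₀` of `S` in the chart makes the ideal proper. If a product vanishes on the chart
part of `S`, the closed sets attached to the two factors cover `S`, points off the chart being in
both, and irreducibility selects one. -/
theorem chartIdeal_isPrime {n : ℕ} (lam : V →ₗ[ℂ] ℂ) {S : Set (Fin n → ℙ ℂ V)}
    (hS : @IsIrreducible _ (zariskiProjPow V n) S) {v₀ : Fin n → V} (hv₀ : ∀ i, v₀ i ≠ 0)
    (hl : ∀ i, lam (v₀ i) ≠ 0)
    (hS₀ : (fun i => Projectivization.mk ℂ (v₀ i) (hv₀ i)) ∈ S) :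
    (chartIdeal lam S).IsPrime := by
  refine ⟨?_, ?_⟩
  · rw [Ideal.ne_top_iff_one]
    intro h
    refine one_ne_zero (h (fun i => (lam (v₀ i))⁻¹ • v₀ i)
      (fun i => smul_ne_zero (inv_ne_zero (hl i)) (hv₀ i)) (fun i => ?_) ?_)
    · rw [map_smul, smul_eq_mul, inv_mul_cancel₀ (hl i)]
    · rwa [mk_inv_smul lam hv₀ hl]
  · intro p q hpq
    obtain ⟨E, hE, hEp⟩ := exists_isClosed_chart lam p.2
    obtain ⟨F, hF, hFq⟩ := exists_isClosed_chart lam q.2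
    have hsub : S ⊆ E ∪ F := by
      intro x hx
      obtain ⟨v, hv, rfl⟩ : ∃ (v : Fin n → V) (hv : ∀ i, v i ≠ 0),
          (fun i => Projectivization.mk ℂ (v i) (hv i)) = x :=
        ⟨fun i => (x i).rep, fun i => (x i).rep_nonzero, funext fun i => (x i).mk_rep⟩
      rw [Set.mem_union, hEp, hFq]
      by_cases hlv : ∀ i, lam (v i) ≠ 0
      · have h := hpq (fun i => (lam (v i))⁻¹ • v i)
          (fun i => smul_ne_zero (inv_ne_zero (hlv i)) (hv i)) (fun i => by
            rw [map_smul, smul_eq_mul, inv_mul_cancel₀ (hlv i)])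
          (by rwa [mk_inv_smul lam hv hlv])
        exact (mul_eq_zero.1 h).imp (fun h _ => h) (fun h _ => h)
      · exact Or.inl fun h => absurd h hlv
    have key : ∀ (r : polyFun (Fin n → V)) (G : Set (Fin n → ℙ ℂ V)),
        (∀ (v : Fin n → V) (hv : ∀ j, v j ≠ 0),
        (fun j => Projectivization.mk ℂ (v j) (hv j)) ∈ G ↔
          ((∀ i, lam (v i) ≠ 0) → r.1 (fun i => (lam (v i))⁻¹ • v i) = 0)) → S ⊆ G →
        r ∈ chartIdeal lam S := by
      intro r G hG hSG v hv hv1 hvS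
      have := (hG v hv).1 (hSG hvS) (fun i => by rw [hv1]; exact one_ne_zero)
      simpa [hv1] using this
    rcases @isPreirreducible_iff_isClosed_union_isClosed _ (zariskiProjPow V n) S |>.1 hS.2 _ _
      hE hF hsub with h | h
    · exact Or.inl (key p E hEp h)
    · exact Or.inr (key q F hFq h)

theorem chartIdeal_anti {n : ℕ} (lam : V →ₗ[ℂ] ℂ) {S T : Set (Fin n → ℙ ℂ V)} (h : S ⊆ T) :
    chartIdeal lam T ≤ chartIdeal lam S := fun _ hq v hv h1 hvS => hq v hv h1 (h hvS)

/-- A point of `T` outside the closure of `S` could lie off the chart. As `T` is irreducible and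
meets the chart, it is not covered by that closure and the complement of the chart, so a separating
point exists inside the chart. -/
theorem exists_mem_chartIdeal_sdiff {n : ℕ} (lam : V →ₗ[ℂ] ℂ) {S T : Set (Fin n → ℙ ℂ V)}
    (hT : @IsIrreducible _ (zariskiProjPow V n) T) {v₀ : Fin n → V} (hv₀ : ∀ i, v₀ i ≠ 0)
    (hl : ∀ i, lam (v₀ i) ≠ 0)
    (hT₀ : (fun i => Projectivization.mk ℂ (v₀ i) (hv₀ i)) ∈ T)
    (h : ¬ T ⊆ @closure _ (zariskiProjPow V n) S) :
    ∃ q, q ∈ chartIdeal lam S ∧ q ∉ chartIdeal lam T := by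
  let _ := zariskiProjPow V n
  -- The closed set of the constant `1` is the complement of the chart.
  obtain ⟨U, hU, hUq⟩ := exists_isClosed_chart (n := n) lam (const_mem_polyFun 1)
  have h1 : ¬ T ⊆ closure S ∪ U := by
    intro hsub
    rcases isPreirreducible_iff_isClosed_union_isClosed.1 hT.2 _ _ isClosed_closure hU hsub
      with h' | h'
    · exact h h'
    · exact one_ne_zero ((hUq v₀ hv₀).1 (h' hT₀) hl)
  obtain ⟨x, hxT, hx⟩ := Set.not_subset.1 h1
  obtain ⟨v, hv, rfl⟩ : ∃ (v : Fin n → V) (hv : ∀ i, v i ≠ 0),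
      (fun i => Projectivization.mk ℂ (v i) (hv i)) = x :=
    ⟨fun i => (x i).rep, fun i => (x i).rep_nonzero, funext fun i => (x i).mk_rep⟩
  rw [Set.mem_union, not_or, hUq] at hx
  obtain ⟨hxS, hx1⟩ := hx
  have hlv : ∀ i, lam (v i) ≠ 0 := by
    by_contra hcon
    exact hx1 fun h => absurd h hcon
  obtain ⟨Q, hQ, hEq⟩ := exists_of_isClosed_zariskiProjPow (isClosed_closure (s := S))
  rw [← mk_inv_smul lam hv hlv, hEq] at hxS
  push Not at hxS
  obtain ⟨q, hqQ, hqv⟩ := hxS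
  refine ⟨⟨q, hQ hqQ⟩, fun w hw _ hwS => (hEq w hw).1 (subset_closure hwS) q hqQ, fun hmem => ?_⟩
  refine hqv (hmem _ (fun i => smul_ne_zero (inv_ne_zero (hlv i)) (hv i)) (fun i => ?_) ?_)
  · rw [map_smul, smul_eq_mul, inv_mul_cancel₀ (hlv i)]
  · rwa [mk_inv_smul lam hv hlv]

end Charts

/-! ### The multiplication map on tuples of lines -/

section Psi

variable {d : ℕ}

theorem continuous_psi :
    @Continuous _ _ (zariskiProjPow (Form 1) d) (zariskiProj (Form d)) psi := by
  let _ := zariskiProjPow (Form 1) d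
  let _ := zariskiProj (Form d)
  refine continuous_iff_isClosed.2 fun E hE => ?_
  obtain ⟨T, hT, hEq⟩ := exists_of_isClosed_zariskiProj hE
  refine isClosed_zariskiProjPow (ι := T) (q := fun q v => q.1 (prodForm v))
    (fun q => isPolyMap_prodForm.comp_mem (hT q.2)) fun v hv => ?_
  rw [Set.mem_preimage, psi_mk v hv, hEq]
  simp

/-- Restriction of a form to the line through `p` and `u`, parametrized by `T ↦ T p - u`. -/
noncomputable def lineRestrict (p u : Fin 3 → ℂ) : MvPolynomial (Fin 3) ℂ →ₐ[ℂ] Polynomial ℂ :=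
  MvPolynomial.aeval fun j => Polynomial.C (p j) * Polynomial.X - Polynomial.C (u j)

theorem lineRestrict_form (p u : Fin 3 → ℂ) (v : Form 1) :
    lineRestrict p u v.1 =
      Polynomial.C (evalAt p v) * Polynomial.X - Polynomial.C (evalAt u v) := by
  obtain ⟨r, rfl⟩ := lin_surjective v
  rw [evalAt_lin, evalAt_lin, coe_lin, lineRestrict]
  simp only [map_sum, map_mul, MvPolynomial.aeval_X, MvPolynomial.algHom_C,
    Polynomial.algebraMap_eq, dotProduct, Finset.sum_mul, ← Finset.sum_sub_distrib]
  exact Finset.sum_congr rfl fun j _ => by ring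

theorem lineRestrict_prodForm {p : Fin 3 → ℂ} (u : Fin 3 → ℂ) {v : Fin d → Form 1}
    (hv : ∀ i, evalAt p (v i) = 1) :
    lineRestrict p u (prodForm v).1 =
      ∏ i, (Polynomial.X - Polynomial.C (evalAt u (v i))) := by
  change lineRestrict p u (∏ i : Fin d, (v i).1) = _
  rw [map_prod]
  refine Finset.prod_congr rfl fun i _ => ?_
  rw [lineRestrict_form, hv, map_one, one_mul]

/-- In the chart where the equations take the value `1` at `p`, the values of the lines at any
other point are integral over the coefficients of their product. -/
theorem exists_monic_evalAt (p u : Fin 3 → ℂ) (i : Fin d)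
    (S : Set (Fin d → ℙ ℂ (Form 1))) (x : polyFun (Fin d → Form 1))
    (hx : ∀ v, x.1 v = evalAt u (v i)) :
    IntegralMod (isPolyMap_prodForm (d := d)).pullback.toRingHom (chartIdeal (evalAt p) S) x := by
  -- The coefficients of the form restricted to `T ↦ T p - u`. On the chart a product of lines
  -- restricts to a monic polynomial of degree `d` with roots `evalAt u (v j)`, so `P`, with leading
  -- coefficient set to `1`, kills `x` there.
  let a : ℕ → polyFun (Form d) := fun k =>
    ⟨_, dual_mem_polyFun ((Polynomial.lcoeff ℂ k).comp
      ((lineRestrict p u).toLinearMap.comp (Submodule.subtype _)))⟩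
  let P : Polynomial (polyFun (Form d)) :=
    Polynomial.X ^ d + ∑ k : Fin d, Polynomial.C (a k) * Polynomial.X ^ (k : ℕ)
  refine ⟨P, Polynomial.monic_X_pow_add ?_, ?_⟩
  · refine (Polynomial.degree_sum_fin_lt fun k : Fin d => a k).trans_eq ?_
    rfl
  · intro v hv hv1 _
    have heval : (P.eval₂ (isPolyMap_prodForm (d := d)).pullback.toRingHom x).1 v =
        x.1 v ^ d + ∑ k : Fin d,
          (lineRestrict p u (prodForm v).1).coeff k * x.1 v ^ (k : ℕ) := by
      simp only [P, Polynomial.eval₂_add, Polynomial.eval₂_pow, Polynomial.eval₂_X,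
        Polynomial.eval₂_finsetSum, Polynomial.eval₂_mul, Polynomial.eval₂_C]
      rw [AddMemClass.coe_add, AddSubmonoidClass.coe_finsetSum]
      simp only [Pi.add_apply, Finset.sum_apply]
      rfl
    rw [heval, lineRestrict_prodForm u hv1]
    set G : Polynomial ℂ := ∏ j, (Polynomial.X - Polynomial.C (evalAt u (v j))) with hG
    have hmonic : G.Monic := Polynomial.monic_prod_X_sub_C _ _
    have hdeg : G.natDegree = d := by
      rw [hG, Polynomial.natDegree_finsetProd_X_sub_C_eq_card]; simp
    have hsum : G.eval (x.1 v) = x.1 v ^ d + ∑ k : Fin d, G.coeff k * x.1 v ^ (k : ℕ) := by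
      rw [Polynomial.eval_eq_sum_range, hdeg, Finset.sum_range_succ, add_comm,
        Finset.sum_range fun k => G.coeff k * x.1 v ^ k]
      congr 1
      have := hmonic.coeff_natDegree
      rw [hdeg] at this
      rw [this, one_mul]
    rw [← hsum, hG, Polynomial.eval_prod, hx]
    exact Finset.prod_eq_zero (Finset.mem_univ i) (by simp)

theorem dual_eq_sum_evalAt (φ : Module.Dual ℂ (Fin d → Form 1)) :
    φ = ∑ i, ∑ j, φ (Pi.single i (lin (Pi.single j 1))) •
      ((evalAt (Pi.single j 1) : Form 1 →ₗ[ℂ] ℂ).comp (LinearMap.proj i)) := by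
  classical
  refine LinearMap.pi_ext' fun i => (LinearMap.cancel_right lin_surjective).1 ?_
  refine LinearMap.pi_ext' fun j => LinearMap.ext_ring ?_
  simp only [LinearMap.comp_apply, LinearMap.sum_apply, LinearMap.smul_apply, LinearMap.proj_apply,
    LinearMap.single_apply]
  rw [Finset.sum_eq_single i, Finset.sum_eq_single j]
  · simp [evalAt_lin]
  · intro k _ hk
    simp [evalAt_lin, hk]
  · simp
  · intro k _ hk
    simp [Pi.single_eq_of_ne hk]
  · simp

theorem polyFun_le_adjoin_evalAt :
    polyFun (Fin d → Form 1) ≤ Algebra.adjoin ℂ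
      {q | ∃ (u : Fin 3 → ℂ) (i : Fin d), q = fun v => evalAt u (v i)} := by
  refine Algebra.adjoin_le ?_
  rintro _ ⟨φ, rfl⟩
  have : (φ : (Fin d → Form 1) → ℂ) = ∑ i, ∑ j, φ (Pi.single i (lin (Pi.single j 1))) •
      fun v : Fin d → Form 1 => evalAt (Pi.single j 1) (v i) := by
    funext v
    conv_lhs => rw [dual_eq_sum_evalAt φ]
    simp
  dsimp only
  rw [SetLike.mem_coe, this]
  exact sum_mem fun i _ => sum_mem fun j _ =>
    Subalgebra.smul_mem _ (Algebra.subset_adjoin (show _ ∈ {q : (Fin d → Form 1) → ℂ |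
      ∃ (u : Fin 3 → ℂ) (i : Fin d), q = fun v => evalAt u (v i)} from ⟨_, i, rfl⟩)) _

/-- Finiteness of `psi` over the chart: the evaluations of the individual lines generate all
polynomial functions, and each is integral. -/
theorem exists_monic_chart (p : Fin 3 → ℂ) (S : Set (Fin d → ℙ ℂ (Form 1)))
    (x : polyFun (Fin d → Form 1)) :
    IntegralMod (isPolyMap_prodForm (d := d)).pullback.toRingHom (chartIdeal (evalAt p) S) x := by
  have key : ∀ q ∈ Algebra.adjoin ℂ {q : (Fin d → Form 1) → ℂ |
      ∃ (u : Fin 3 → ℂ) (i : Fin d), q = fun v => evalAt u (v i)},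
      ∃ y : polyFun (Fin d → Form 1), y.1 = q ∧ IntegralMod
        (isPolyMap_prodForm (d := d)).pullback.toRingHom (chartIdeal (evalAt p) S) y := by
    intro q hq
    induction hq using Algebra.adjoin_induction with
    | mem q hq =>
      obtain ⟨u, i, rfl⟩ := hq
      exact ⟨⟨_, dual_mem_polyFun ((evalAt u : Form 1 →ₗ[ℂ] ℂ).comp (LinearMap.proj i))⟩, rfl,
        exists_monic_evalAt p u i S _ fun v => rfl⟩
    | algebraMap c => exact ⟨_, rfl, IntegralMod.map _ _ (algebraMap ℂ (polyFun (Form d)) c)⟩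
    | add a b ha hb h1 h2 =>
      obtain ⟨y, rfl, hy⟩ := h1
      obtain ⟨z, rfl, hz⟩ := h2
      exact ⟨y + z, rfl, hy.add hz⟩
    | mul a b ha hb h1 h2 =>
      obtain ⟨y, rfl, hy⟩ := h1
      obtain ⟨z, rfl, hz⟩ := h2
      exact ⟨y * z, rfl, hy.mul hz⟩
  obtain ⟨y, hyx, hy⟩ := key x.1 (polyFun_le_adjoin_evalAt x.2)
  rwa [Subtype.ext hyx] at hy

/-- `psi` preserves strict inclusions of closures of irreducible sets. -/
theorem not_image_psi_subset_closure {C D : Set (Fin d → ℙ ℂ (Form 1))}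
    (hC : @IsIrreducible _ (zariskiProjPow (Form 1) d) C)
    (hD : @IsIrreducible _ (zariskiProjPow (Form 1) d) D) (hCD : C ⊆ D)
    (h : ¬ D ⊆ @closure _ (zariskiProjPow (Form 1) d) C) :
    ¬ psi '' D ⊆ @closure _ (zariskiProj (Form d)) (psi '' C) := by
  obtain ⟨x, hx⟩ := hC.1
  obtain ⟨v₀, hv₀, rfl⟩ : ∃ (v : Fin d → Form 1) (hv : ∀ i, v i ≠ 0),
      (fun i => Projectivization.mk ℂ (v i) (hv i)) = x :=
    ⟨fun i => (x i).rep, fun i => (x i).rep_nonzero, funext fun i => (x i).mk_rep⟩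
  -- A point off all lines of one member of `C` defines a chart that meets both `C` and `D`.
  obtain ⟨p, hp⟩ : ∃ p, evalAt p (prodForm v₀) ≠ 0 := by
    by_contra! hcon
    exact prodForm_ne_zero hv₀ (Subtype.ext (MvPolynomial.funext fun p =>
      (hcon p).trans (map_zero _).symm))
  rw [evalAt_prodForm] at hp
  have hl : ∀ i, evalAt p (v₀ i) ≠ 0 := fun i =>
    Finset.prod_ne_zero_iff.1 hp i (Finset.mem_univ i)
  have hprime := chartIdeal_isPrime (evalAt p) hD hv₀ hl (hCD hx)
  obtain ⟨x, hxC, hxD⟩ := exists_mem_chartIdeal_sdiff (evalAt p) hD hv₀ hl (hCD hx) h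
  obtain ⟨P, hP, hPx⟩ := exists_monic_chart p D x
  have hprime' := Ideal.comap_isPrime (isPolyMap_prodForm (d := d)).pullback.toRingHom
    (chartIdeal (evalAt p) D)
  -- Incomparability: an integral element in the larger ideal but not in the smaller prime makes the
  -- contractions to `polyFun (Form d)` differ. A function `q` in the difference separates the
  -- images.
  have hlt := Ideal.comap_lt_comap_of_root_mem_sdiff (chartIdeal_anti (evalAt p) hCD) ⟨hxC, hxD⟩
    (Polynomial.map_monic_ne_zero hP) hPx
  obtain ⟨q, hqC, hqD⟩ := SetLike.exists_of_lt hlt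
  obtain ⟨E, hE, hEq⟩ := exists_isClosed_chart_single (evalAt p) q.2
  intro hsub
  have hCE : psi '' C ⊆ E := by
    rintro _ ⟨y, hy, rfl⟩
    obtain ⟨v, hv, rfl⟩ : ∃ (v : Fin d → Form 1) (hv : ∀ i, v i ≠ 0),
        (fun i => Projectivization.mk ℂ (v i) (hv i)) = y :=
      ⟨fun i => (y i).rep, fun i => (y i).rep_nonzero, funext fun i => (y i).mk_rep⟩
    rw [psi_mk, hEq, evalAt_prodForm]
    intro h0
    have hlv : ∀ i, evalAt p (v i) ≠ 0 := fun i =>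
      Finset.prod_ne_zero_iff.1 h0 i (Finset.mem_univ i)
    -- Normalizing the product at `p` is the same as normalizing every factor at `p`.
    rw [← Finset.prod_inv_distrib, ← prodForm_smul]
    refine hqC _ (fun i => smul_ne_zero (inv_ne_zero (hlv i)) (hv i)) (fun i => ?_) ?_
    · rw [map_smul, smul_eq_mul, inv_mul_cancel₀ (hlv i)]
    · rwa [mk_inv_smul (evalAt p) hv hlv]
  have hDE := hsub.trans (@closure_minimal _ (zariskiProj (Form d)) _ _ hCE hE)
  refine hqD fun v hv hv1 hvD => ?_
  have := (hEq _ _).1 (psi_mk v hv ▸ hDE ⟨_, hvD, rfl⟩)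
  rw [evalAt_prodForm, Finset.prod_congr rfl fun i _ => hv1 i, Finset.prod_const_one, inv_one,
    one_smul] at this
  exact this one_ne_zero

theorem withBot_enat_le_of_forall {a b : WithBot ℕ∞}
    (h : ∀ n : ℕ, (n : WithBot ℕ∞) ≤ a → (n : WithBot ℕ∞) ≤ b) : a ≤ b := by
  induction b using WithBot.recBotCoe with
  | bot =>
    induction a using WithBot.recBotCoe with
    | bot => exact le_rfl
    | coe a => exact absurd (h 0 (WithBot.coe_le_coe.2 (zero_le (a := a)))) (by simp)
  | coe b =>
    induction b using ENat.recTopCoe with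
    | top =>
      induction a using WithBot.recBotCoe with
      | bot => exact bot_le
      | coe a => exact WithBot.coe_le_coe.2 le_top
    | coe m => exact withBot_enat_le_natCast fun n hn => by exact_mod_cast h n hn

/-- The orbit of a tuple of lines is at most as large as the orbit of the product. -/
theorem dimProjPow_orbit_le (l : Fin d → ℙ ℂ (Form 1)) :
    dimProjPow (MulAction.orbit PGL(3, ℂ) l) ≤ dimProj (MulAction.orbit PGL(3, ℂ) (psi l)) := by
  let _ := zariskiProjPow (Form 1) d
  let _ := zariskiProj (Form d)
  refine withBot_enat_le_of_forall fun n hn => ?_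
  obtain ⟨S, hS, hS'⟩ := le_topologicalKrullDim_subtype_iff.1 hn
  refine le_topologicalKrullDim_subtype_iff.2 ⟨fun i => psi '' S i, fun i hi => ⟨?_, ?_⟩,
    fun i hi => ⟨Set.image_mono (hS' i hi).1, ?_⟩⟩
  · exact (hS i hi).1.image _ continuous_psi.continuousOn
  · rw [orbit_psi]
    exact Set.image_mono (hS i hi).2
  · exact not_image_psi_subset_closure (hS i hi.le).1 (hS (i + 1) hi).1 (hS' i hi).1 (hS' i hi).2

end Psi

/-! ### Upper bounds for orbits of products of lines -/

section UpperBound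

variable {d : ℕ} {r : Fin d → Fin 3 → ℂ} (hr : ∀ i, r i ≠ 0)

theorem exists_forall_dotProduct_ne_zero (hr : ∀ i, r i ≠ 0) : ∃ p : Fin 3 → ℂ, ∀ i, r i ⬝ᵥ p ≠ 0 := by
  obtain ⟨p, hp⟩ : ∃ p, evalAt p (prodForm fun i => lin (r i)) ≠ 0 := by
    by_contra! hcon
    exact prodForm_ne_zero (fun i => lin_ne_zero (hr i)) (Subtype.ext
      (MvPolynomial.funext fun p => (hcon p).trans (map_zero _).symm))
  rw [evalAt_prodForm] at hp
  exact ⟨p, fun i => evalAt_lin p (r i) ▸ Finset.prod_ne_zero_iff.1 hp i (Finset.mem_univ i)⟩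

/-- With `p` off all lines, this singular matrix shows that the condition "all last entries are
nonzero" is satisfiable, which is all a density argument over matrices needs. -/
theorem vecMul_lastColumn (s p : Fin 3 → ℂ) :
    Matrix.vecMul s (Matrix.of fun i (j : Fin 3) => if j = 2 then p i else 0) 2 = s ⬝ᵥ p := by
  simp [Matrix.vecMul, dotProduct]

/-- Two affine coordinates for each line and one overall scalar give `2 * d + 1` parameters. They
reach only lines with nonzero last coefficient; the other matrices are covered by density. -/
theorem dimProj_orbit_le_two_mul :
    dimProj (MulAction.orbit PGL(3, ℂ) (psi (lines r hr))) ≤ (2 * d : ℕ) := by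
  refine dimProj_le (W := (Fin d → Fin 2 → ℂ) × ℂ)
    (Φ := fun w => w.2 • prodForm fun i => lin ![w.1 i 0, w.1 i 1, 1]) ?_ ?_ ?_
  · rw [Module.finrank_prod, Module.finrank_pi_fintype]
    simp [mul_comm]
  · have h : ∀ i, IsPolyMap fun w : (Fin d → Fin 2 → ℂ) × ℂ => ![w.1 i 0, w.1 i 1, 1] := by
      refine fun i => isPolyMap_pi fun j => ?_
      fin_cases j
      · change IsPolyMap fun w : (Fin d → Fin 2 → ℂ) × ℂ => w.1 i 0
        fun_prop
      · change IsPolyMap fun w : (Fin d → Fin 2 → ℂ) × ℂ => w.1 i 1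
        fun_prop
      · exact isPolyMap_const 1
    fun_prop
  · intro q hq hqΦ v hv hvmem
    obtain ⟨c, N, rfl⟩ := exists_of_mk_mem_orbit hr hvmem
    obtain ⟨p, hp⟩ := exists_forall_dotProduct_ne_zero hr
    have hent : ∀ a b, IsPolyMap fun N : Matrix (Fin 3) (Fin 3) ℂ => N a b := fun a b =>
      isPolyMap_linear (Matrix.entryLinearMap ℂ ℂ a b)
    have hvec := fun i => IsPolyMap.vecMul hent (r i)
    have h1 : IsPolyMap fun N : Matrix (Fin 3) (Fin 3) ℂ => ∏ i, Matrix.vecMul (r i) N 2 := by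
      fun_prop
    have h2 : IsPolyMap fun N : Matrix (Fin 3) (Fin 3) ℂ =>
        c • prodForm fun i => lin (Matrix.vecMul (r i) N) := by
      fun_prop
    refine polyFun_eq_zero_of_mul (isPolyMap_complex.1 h1) (h2.comp_mem hq)
      ⟨Matrix.of fun i j => if j = 2 then p i else 0, ?_⟩ ?_ N.1
    · exact Finset.prod_ne_zero_iff.2 fun i _ => by rw [vecMul_lastColumn]; exact hp i
    · intro N hN
      have hN' : ∀ i, Matrix.vecMul (r i) N 2 ≠ 0 := fun i =>
        Finset.prod_ne_zero_iff.1 hN i (Finset.mem_univ i)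
      let s := fun i => Matrix.vecMul (r i) N 2
      have key : (c • prodForm fun i => lin (Matrix.vecMul (r i) N)) =
          (c * ∏ i, s i) • prodForm fun i =>
            lin ![(s i)⁻¹ * Matrix.vecMul (r i) N 0, (s i)⁻¹ * Matrix.vecMul (r i) N 1, 1] := by
        rw [mul_smul, ← prodForm_smul]
        congr 2
        funext i
        rw [← map_smul]
        congr 1
        funext j
        fin_cases j
        · simp [s, hN' i]
        · simp [s, hN' i]
        · simp [s]
      rw [key]
      exact hqΦ (fun i => ![(s i)⁻¹ * Matrix.vecMul (r i) N 0,
        (s i)⁻¹ * Matrix.vecMul (r i) N 1], c * ∏ i, s i)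

/-- The nine matrix entries parametrize the cone: the scalar `c` is absorbed into the matrix through
a `d`-th root. -/
theorem dimProj_orbit_le_eight (hd : d ≠ 0) :
    dimProj (MulAction.orbit PGL(3, ℂ) (psi (lines r hr))) ≤ (8 : ℕ) := by
  have hent : ∀ a b, IsPolyMap fun N : Matrix (Fin 3) (Fin 3) ℂ => N a b := fun a b =>
    isPolyMap_linear (Matrix.entryLinearMap ℂ ℂ a b)
  have hvec := fun i => IsPolyMap.vecMul hent (r i)
  refine dimProj_le (W := Matrix (Fin 3) (Fin 3) ℂ)
    (Φ := fun N => prodForm fun i => lin (Matrix.vecMul (r i) N)) ?_ (by fun_prop) ?_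
  · simp [Module.finrank_matrix]
  · intro q hq hqΦ v hv hvmem
    obtain ⟨c, N, rfl⟩ := exists_of_mk_mem_orbit hr hvmem
    obtain ⟨e, rfl⟩ := IsAlgClosed.exists_pow_nat_eq c (Nat.pos_of_ne_zero hd)
    have : (e ^ d • prodForm fun i => lin (Matrix.vecMul (r i) N.1)) =
        prodForm fun i => lin (Matrix.vecMul (r i) (e • N.1)) := by
      have := prodForm_smul (fun _ => e) fun i => lin (Matrix.vecMul (r i) N.1)
      rw [Finset.prod_const, Finset.card_univ, Fintype.card_fin] at this
      rw [← this]
      congr 1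
      funext i
      rw [← map_smul, Matrix.vecMul_smul]
    rw [this]
    exact hqΦ _

/-- For lines in a pencil the product depends only on the images of `a` and `b`, six parameters,
with the scalar absorbed by a `d`-th root. -/
theorem dimProj_orbit_le_five (hd : d ≠ 0) {a b : Fin 3 → ℂ} {α β : Fin d → ℂ}
    (h : ∀ i, r i = α i • a + β i • b) :
    dimProj (MulAction.orbit PGL(3, ℂ) (psi (lines r hr))) ≤ (5 : ℕ) := by
  refine dimProj_le (W := Fin 2 → Fin 3 → ℂ)
    (Φ := fun u => prodForm fun i => lin (α i • u 0 + β i • u 1)) ?_ (by fun_prop) ?_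
  · simp [Module.finrank_pi_fintype]
  · intro q hq hqΦ v hv hvmem
    obtain ⟨c, N, rfl⟩ := exists_of_mk_mem_orbit hr hvmem
    obtain ⟨e, rfl⟩ := IsAlgClosed.exists_pow_nat_eq c (Nat.pos_of_ne_zero hd)
    have : (e ^ d • prodForm fun i => lin (Matrix.vecMul (r i) N.1)) =
        prodForm fun i => lin (α i • (e • Matrix.vecMul a N.1) + β i • (e • Matrix.vecMul b N.1)) := by
      have := prodForm_smul (fun _ => e) fun i => lin (Matrix.vecMul (r i) N.1)
      rw [Finset.prod_const, Finset.card_univ, Fintype.card_fin] at this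
      rw [← this]
      congr 1
      funext i
      rw [← map_smul, h, Matrix.add_vecMul, Matrix.smul_vecMul, Matrix.smul_vecMul, smul_add,
        smul_comm e, smul_comm e]
    rw [this]
    exact hqΦ ![e • Matrix.vecMul a N.1, e • Matrix.vecMul b N.1]

/-- Six parameters for the pencil and two for the exceptional line, normalized to last coefficient
`1`. -/
theorem dimProj_orbit_le_seven (hd : 2 ≤ d) {a b : Fin 3 → ℂ} {α β : Fin d → ℂ} (i₀ : Fin d)
    (h : ∀ i, i ≠ i₀ → r i = α i • a + β i • b) :
    dimProj (MulAction.orbit PGL(3, ℂ) (psi (lines r hr))) ≤ (7 : ℕ) := by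
  have hent : ∀ a b, IsPolyMap fun N : Matrix (Fin 3) (Fin 3) ℂ => N a b := fun a b =>
    isPolyMap_linear (Matrix.entryLinearMap ℂ ℂ a b)
  have hvec := fun i => IsPolyMap.vecMul hent (r i)
  refine dimProj_le (W := (Fin 2 → Fin 3 → ℂ) × (Fin 2 → ℂ))
    (Φ := fun w => prodForm fun i =>
      if i = i₀ then lin ![w.2 0, w.2 1, 1] else lin (α i • w.1 0 + β i • w.1 1)) ?_ ?_ ?_
  · simp [Module.finrank_pi_fintype]
  · refine isPolyMap_prodForm.comp (isPolyMap_pi fun i => ?_)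
    split_ifs
    · have h : IsPolyMap fun w : (Fin 2 → Fin 3 → ℂ) × (Fin 2 → ℂ) => ![w.2 0, w.2 1, 1] := by
        refine isPolyMap_pi fun j => ?_
        fin_cases j
        · change IsPolyMap fun w : (Fin 2 → Fin 3 → ℂ) × (Fin 2 → ℂ) => w.2 0
          fun_prop
        · change IsPolyMap fun w : (Fin 2 → Fin 3 → ℂ) × (Fin 2 → ℂ) => w.2 1
          fun_prop
        · exact isPolyMap_const 1
      fun_prop
    · fun_prop
  · intro q hq hqΦ v hv hvmem
    obtain ⟨c, N, rfl⟩ := exists_of_mk_mem_orbit hr hvmem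
    obtain ⟨p, hp⟩ := exists_forall_dotProduct_ne_zero hr
    have h1 : IsPolyMap fun N : Matrix (Fin 3) (Fin 3) ℂ => Matrix.vecMul (r i₀) N 2 := by
      fun_prop
    have h2 : IsPolyMap fun N : Matrix (Fin 3) (Fin 3) ℂ =>
        c • prodForm fun i => lin (Matrix.vecMul (r i) N) := by
      fun_prop
    refine polyFun_eq_zero_of_mul (isPolyMap_complex.1 h1) (h2.comp_mem hq)
      ⟨Matrix.of fun i j => if j = 2 then p i else 0, ?_⟩ ?_ N.1
    · rw [vecMul_lastColumn]; exact hp i₀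
    · intro N hN
      set s := Matrix.vecMul (r i₀) N 2 with hs
      -- The scalar `c` and the factor `s` removed from line `i₀` are spread over the other `d - 1`
      -- lines.
      obtain ⟨e, he⟩ := IsAlgClosed.exists_pow_nat_eq (c * s) (show 0 < d - 1 by omega)
      have key : (c • prodForm fun i => lin (Matrix.vecMul (r i) N)) =
          prodForm fun i => if i = i₀ then
            lin ![s⁻¹ * Matrix.vecMul (r i₀) N 0, s⁻¹ * Matrix.vecMul (r i₀) N 1, 1]
            else lin (α i • (e • Matrix.vecMul a N) + β i • (e • Matrix.vecMul b N)) := by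
        have hc : ∏ i : Fin d, (if i = i₀ then s⁻¹ else e) = c := by
          rw [← Finset.mul_prod_erase _ _ (Finset.mem_univ i₀), if_pos rfl,
            Finset.prod_congr rfl fun i hi => if_neg (Finset.ne_of_mem_erase hi),
            Finset.prod_const, Finset.card_erase_of_mem (Finset.mem_univ _), Finset.card_univ,
            Fintype.card_fin, he]
          field_simp
        rw [← hc, ← prodForm_smul]
        congr 1
        funext i
        split_ifs with hi
        · subst hi
          rw [← map_smul]
          congr 1
          funext j
          fin_cases j
          · simp
          · simp
          · simp [← hs, hN]
        · rw [← map_smul, h i hi, Matrix.add_vecMul, Matrix.smul_vecMul, Matrix.smul_vecMul,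
            smul_add, smul_comm e, smul_comm e]
      rw [key]
      exact hqΦ (![e • Matrix.vecMul a N, e • Matrix.vecMul b N],
        ![s⁻¹ * Matrix.vecMul (r i₀) N 0, s⁻¹ * Matrix.vecMul (r i₀) N 1])

end UpperBound

/-! ### Lower bounds for orbits of tuples of lines -/

section LowerBound

variable {d : ℕ} {r : Fin d → Fin 3 → ℂ} (hr : ∀ i, r i ≠ 0)

/-- Replacing `M t` by `A⁻¹ * M t` lets the lines be given by coordinates `y` in the basis of rows
of `A`. -/
theorem le_dimProjPow_orbit_of_basis {k : ℕ} (A : Matrix (Fin 3) (Fin 3) ℂ) (hA : A.det ≠ 0)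
    (M : (Fin k → ℂ) → Matrix (Fin 3) (Fin 3) ℂ) (hM : ∀ a b, IsPolyMap fun t => M t a b)
    (idx : Fin k → Fin d) (col : Fin k → Fin 3) (y : Fin k → Fin 3 → ℂ)
    (hy : ∀ j, r (idx j) = Matrix.vecMul (y j) A)
    (h : ∀ t j, Matrix.vecMul (y j) (M t) (col j) = t j * Matrix.vecMul (y j) (M t) 2)
    (t₀ : Fin k → ℂ) (hdet : (M t₀).det ≠ 0) (h2 : ∀ j, Matrix.vecMul (y j) (M t₀) 2 ≠ 0) :
    (k : WithBot ℕ∞) ≤ dimProjPow (MulAction.orbit PGL(3, ℂ) (lines r hr)) := by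
  have hu : IsUnit A.det := isUnit_iff_ne_zero.2 hA
  have hmul : ∀ t j, Matrix.vecMul (r (idx j)) (A⁻¹ * M t) = Matrix.vecMul (y j) (M t) := by
    intro t j
    rw [hy, Matrix.vecMul_vecMul, ← mul_assoc, Matrix.mul_nonsing_inv A hu, one_mul]
  refine le_dimProjPow_orbit hr (fun t => A⁻¹ * M t) (fun a b => ?_) idx col (fun t j => ?_) t₀
    ?_ fun j => ?_
  · simp only [Matrix.mul_apply]
    fun_prop
  · rw [hmul, h]
  · rw [Matrix.det_mul]
    exact mul_ne_zero (by simpa using hA) hdet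
  · rw [hmul]
    exact h2 j

theorem two_mul_le_dimProjPow_orbit (A : Matrix (Fin 3) (Fin 3) ℂ) (hA : A.det ≠ 0)
    (hd : d ≤ 3) (h : ∀ i, r i = A (Fin.castLE hd i)) :
    ((2 * d : ℕ) : WithBot ℕ∞) ≤ dimProjPow (MulAction.orbit PGL(3, ℂ) (lines r hr)) := by
  -- Any invertible matrix with last column `1` would do. The first two entries of its first `d`
  -- rows become free, with parameter `2 * i + c` in row `i` and column `c`.
  let M₀ : Matrix (Fin 3) (Fin 3) ℂ := !![1, 0, 1; 0, 1, 1; 0, 0, 1]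
  let M : (Fin (2 * d) → ℂ) → Matrix (Fin 3) (Fin 3) ℂ := fun t => Matrix.of fun i c =>
    if h : i.1 < d ∧ c.1 < 2 then t ⟨2 * i.1 + c.1, by omega⟩ else M₀ i c
  let idx : Fin (2 * d) → Fin d := fun j => ⟨j.1 / 2, by omega⟩
  let col : Fin (2 * d) → Fin 3 := fun j => ⟨j.1 % 2, by omega⟩
  let t₀ : Fin (2 * d) → ℂ := fun j => M₀ (Fin.castLE hd (idx j)) (col j)
  have hM2 : ∀ t i, M t i 2 = 1 := by
    intro t i
    simp only [M, Matrix.of_apply]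
    rw [dif_neg (by simp)]
    fin_cases i <;> simp [M₀]
  have hMt₀ : M t₀ = M₀ := by
    ext i c
    simp only [M, Matrix.of_apply]
    split_ifs with hic
    · simp only [t₀]
      congr 1
      · exact Fin.ext (by simp [idx]; omega)
      · exact Fin.ext (by simp [col]; omega)
    · rfl
  refine le_dimProjPow_orbit_of_basis hr A hA M (fun a b => ?_) idx col
    (fun j => Pi.single (Fin.castLE hd (idx j)) 1) (fun j => ?_) (fun t j => ?_) t₀ ?_ fun j => ?_
  · simp only [M, Matrix.of_apply]
    split_ifs <;> fun_prop
  · rw [h, Matrix.single_one_vecMul]; rfl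
  · rw [Matrix.single_one_vecMul, Matrix.row_apply, Matrix.row_apply, hM2, mul_one]
    simp only [M, Matrix.of_apply]
    rw [dif_pos ⟨(idx j).2, by simp [col]; omega⟩]
    congr 1
    exact Fin.ext (by simp [idx, col]; omega)
  · rw [hMt₀]
    simp [M₀, Matrix.det_fin_three]
  · rw [Matrix.single_one_vecMul, Matrix.row_apply, hM2]
    exact one_ne_zero

/-- Two lines move freely, `t 0` to `t 3`, and a third moves in their pencil. Since `(t 4 - t 2) * t
0 + (t 0 - t 4) * t 2 = t 4 * (t 0 - t 2)`, the chosen row scalings give the third line first affine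
coordinate `t 4`. -/
theorem five_le_dimProjPow_orbit (A : Matrix (Fin 3) (Fin 3) ℂ) (hA : A.det ≠ 0)
    {i₁ i₂ i₃ : Fin d} {α β : ℂ} (hα : α ≠ 0) (hβ : β ≠ 0) (h₁ : r i₁ = A 0) (h₂ : r i₂ = A 1)
    (h₃ : r i₃ = α • A 0 + β • A 1) :
    ((5 : ℕ) : WithBot ℕ∞) ≤ dimProjPow (MulAction.orbit PGL(3, ℂ) (lines r hr)) := by
  let M : (Fin 5 → ℂ) → Matrix (Fin 3) (Fin 3) ℂ := fun t =>
    !![α⁻¹ * (t 4 - t 2) * t 0, α⁻¹ * (t 4 - t 2) * t 1, α⁻¹ * (t 4 - t 2);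
       β⁻¹ * (t 0 - t 4) * t 2, β⁻¹ * (t 0 - t 4) * t 3, β⁻¹ * (t 0 - t 4);
       0, 0, 1]
  refine le_dimProjPow_orbit_of_basis hr A hA M (fun a b => ?_) ![i₁, i₁, i₂, i₂, i₃]
    ![0, 1, 0, 1, 0] ![![1, 0, 0], ![1, 0, 0], ![0, 1, 0], ![0, 1, 0], ![α, β, 0]]
    (fun j => ?_) (fun t j => ?_) ![1, 0, -1, 1, 0] ?_ fun j => ?_
  · fin_cases a <;> fin_cases b <;> simp [M] <;> fun_prop
  · fin_cases j <;> ext c <;> simp [h₁, h₂, h₃, Matrix.vecMul, dotProduct, Fin.sum_univ_three]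
  · fin_cases j <;> simp [M, Matrix.vecMul, dotProduct, Fin.sum_univ_three] <;> field_simp <;> ring
  · simp [M, Matrix.det_fin_three, hα, hβ]
  · fin_cases j <;> simp [M, Matrix.vecMul, dotProduct, Fin.sum_univ_three, hα, hβ]

/-- The pencil family of `five_le_dimProjPow_orbit`, with the line off the pencil contributing its
own two coordinates. -/
theorem seven_le_dimProjPow_orbit (A : Matrix (Fin 3) (Fin 3) ℂ) (hA : A.det ≠ 0)
    {i₁ i₂ i₃ i₄ : Fin d} {α β : ℂ} (hα : α ≠ 0) (hβ : β ≠ 0) (h₁ : r i₁ = A 0) (h₂ : r i₂ = A 1)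
    (h₃ : r i₃ = α • A 0 + β • A 1) (h₄ : r i₄ = A 2) :
    ((7 : ℕ) : WithBot ℕ∞) ≤ dimProjPow (MulAction.orbit PGL(3, ℂ) (lines r hr)) := by
  let M : (Fin 7 → ℂ) → Matrix (Fin 3) (Fin 3) ℂ := fun t =>
    !![α⁻¹ * (t 4 - t 2) * t 0, α⁻¹ * (t 4 - t 2) * t 1, α⁻¹ * (t 4 - t 2);
       β⁻¹ * (t 0 - t 4) * t 2, β⁻¹ * (t 0 - t 4) * t 3, β⁻¹ * (t 0 - t 4);
       t 5, t 6, 1]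
  refine le_dimProjPow_orbit_of_basis hr A hA M (fun a b => ?_) ![i₁, i₁, i₂, i₂, i₃, i₄, i₄]
    ![0, 1, 0, 1, 0, 0, 1]
    ![![1, 0, 0], ![1, 0, 0], ![0, 1, 0], ![0, 1, 0], ![α, β, 0], ![0, 0, 1], ![0, 0, 1]]
    (fun j => ?_) (fun t j => ?_) ![1, 0, -1, 1, 0, 0, 0] ?_ fun j => ?_
  · fin_cases a <;> fin_cases b <;> simp [M] <;> fun_prop
  · fin_cases j <;> ext c <;>
      simp [h₁, h₂, h₃, h₄, Matrix.vecMul, dotProduct, Fin.sum_univ_three]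
  · fin_cases j <;> simp [M, Matrix.vecMul, dotProduct, Fin.sum_univ_three] <;> field_simp <;> ring
  · simp [M, Matrix.det_fin_three, hα, hβ]
  · fin_cases j <;> simp [M, Matrix.vecMul, dotProduct, Fin.sum_univ_three, hα, hβ]

theorem eight_le_dimProjPow_orbit (A : Matrix (Fin 3) (Fin 3) ℂ) (hA : A.det ≠ 0)
    {i₁ i₂ i₃ i₄ : Fin d} {α β γ : ℂ} (hα : α ≠ 0) (hβ : β ≠ 0) (hγ : γ ≠ 0)
    (h₁ : r i₁ = A 0) (h₂ : r i₂ = A 1) (h₃ : r i₃ = A 2)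
    (h₄ : r i₄ = α • A 0 + β • A 1 + γ • A 2) :
    ((8 : ℕ) : WithBot ℕ∞) ≤ dimProjPow (MulAction.orbit PGL(3, ℂ) (lines r hr)) := by
  -- `D` is the determinant of three affine points with last coordinate `1`. By Cramer's rule the
  -- row scalings `x`, `y`, `z` send the fourth line to a multiple of `(t 6, t 7, 1)`. The base
  -- point used below is a triangle with its barycenter.
  let D : (ℂ × ℂ) → (ℂ × ℂ) → (ℂ × ℂ) → ℂ := fun p q s =>
    p.1 * (q.2 - s.2) - p.2 * (q.1 - s.1) + (q.1 * s.2 - q.2 * s.1)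
  let x : (Fin 8 → ℂ) → ℂ := fun t => α⁻¹ * D (t 6, t 7) (t 2, t 3) (t 4, t 5)
  let y : (Fin 8 → ℂ) → ℂ := fun t => β⁻¹ * D (t 0, t 1) (t 6, t 7) (t 4, t 5)
  let z : (Fin 8 → ℂ) → ℂ := fun t => γ⁻¹ * D (t 0, t 1) (t 2, t 3) (t 6, t 7)
  let M : (Fin 8 → ℂ) → Matrix (Fin 3) (Fin 3) ℂ := fun t =>
    !![x t * t 0, x t * t 1, x t; y t * t 2, y t * t 3, y t; z t * t 4, z t * t 5, z t]
  have hx : IsPolyMap x := by simp only [x, D]; fun_prop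
  have hy : IsPolyMap y := by simp only [y, D]; fun_prop
  have hz : IsPolyMap z := by simp only [z, D]; fun_prop
  refine le_dimProjPow_orbit_of_basis hr A hA M (fun a b => ?_) ![i₁, i₁, i₂, i₂, i₃, i₃, i₄, i₄]
    ![0, 1, 0, 1, 0, 1, 0, 1]
    ![![1, 0, 0], ![1, 0, 0], ![0, 1, 0], ![0, 1, 0], ![0, 0, 1], ![0, 0, 1], ![α, β, γ],
      ![α, β, γ]]
    (fun j => ?_) (fun t j => ?_) ![1, 0, 0, 1, -1, -1, 0, 0] ?_ fun j => ?_
  · fin_cases a <;> fin_cases b <;> simp [M] <;> fun_prop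
  · fin_cases j <;> ext c <;>
      simp [h₁, h₂, h₃, h₄, Matrix.vecMul, dotProduct, Fin.sum_univ_three]
  · fin_cases j <;> simp [M, Matrix.vecMul, dotProduct, Fin.sum_univ_three]
    any_goals ring1
    all_goals
      simp only [x, y, z, D]
      field_simp
      ring
  · have : (M ![1, 0, 0, 1, -1, -1, 0, 0]).det = 3 * (α⁻¹ * β⁻¹ * γ⁻¹) := by
      simp [M, x, y, z, D, Matrix.det_fin_three]
      ring
    rw [this]
    simp [hα, hβ, hγ]
  · fin_cases j <;> simp [M, x, y, z, D, Matrix.vecMul, dotProduct, Fin.sum_univ_three, hα, hβ, hγ]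
    all_goals norm_num

end LowerBound

/-! ### Linear algebra in dimension three -/

section LinearAlgebra

variable {u v w s p : Fin 3 → ℂ}

/-- The matrix with given rows. -/
abbrev rowMatrix (u v w : Fin 3 → ℂ) : Matrix (Fin 3) (Fin 3) ℂ := Matrix.of ![u, v, w]

theorem dotProduct_crossProduct : u ⬝ᵥ crossProduct v w = (rowMatrix u v w).det :=
  triple_product_eq_det u v w

theorem rowMatrix_smul_add (a b c : ℂ) :
    ![a, b, c] ᵥ* rowMatrix u v w = a • u + b • v + c • w := by
  rw [Matrix.vecMul_eq_sum, Fin.sum_univ_three]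
  rfl

theorem sum_three_of_ne {M : Type*} [AddCommGroup M] (f : Fin 3 → M) {i j k : Fin 3}
    (hij : i ≠ j) (hik : i ≠ k) (hjk : j ≠ k) : f 0 + f 1 + f 2 = f i + f j + f k := by
  fin_cases i <;> fin_cases j <;> fin_cases k <;>
    first | exact absurd rfl hij | exact absurd rfl hik | exact absurd rfl hjk | rfl | (dsimp; abel)

theorem exists_det_ne_zero (h : crossProduct u v ≠ 0) :
    ∃ w : Fin 3 → ℂ, (rowMatrix u v w).det ≠ 0 := by
  obtain ⟨j, hj⟩ := Function.ne_iff.1 h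
  refine ⟨Pi.single j 1, ?_⟩
  rw [← dotProduct_crossProduct, triple_product_permutation, triple_product_permutation,
    single_one_dotProduct]
  exact hj

theorem exists_crossProduct_ne_zero (h : u ≠ 0) : ∃ v : Fin 3 → ℂ, crossProduct u v ≠ 0 := by
  by_contra! hcon
  apply h
  have h0 := hcon ![1, 0, 0]
  have h1 := hcon ![0, 1, 0]
  rw [cross_apply] at h0 h1
  ext j
  fin_cases j
  · simpa using congrFun h1 2
  · simpa using congrFun h0 2
  · simpa using congrFun h0 1

theorem exists_coords (h : (rowMatrix u v w).det ≠ 0) (s : Fin 3 → ℂ) :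
    ∃ x : Fin 3 → ℂ, s = x 0 • u + x 1 • v + x 2 • w := by
  refine ⟨s ᵥ* (rowMatrix u v w)⁻¹, ?_⟩
  have h1 : (s ᵥ* (rowMatrix u v w)⁻¹) ᵥ* rowMatrix u v w = s := by
    rw [Matrix.vecMul_vecMul, Matrix.nonsing_inv_mul _ (isUnit_iff_ne_zero.2 h), Matrix.vecMul_one]
  conv_lhs => rw [← h1, Matrix.vecMul_eq_sum, Fin.sum_univ_three]
  rfl

theorem coords_eq_zero (h : (rowMatrix u v w).det ≠ 0) {a b c : ℂ}
    (h0 : a • u + b • v + c • w = 0) : a = 0 ∧ b = 0 ∧ c = 0 := by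
  rw [← rowMatrix_smul_add] at h0
  have h2 := Matrix.eq_zero_of_vecMul_eq_zero h h0
  exact ⟨congrFun h2 0, congrFun h2 1, congrFun h2 2⟩

theorem eq_zero_of_dotProduct_eq_zero (h : (rowMatrix u v w).det ≠ 0) (hu : u ⬝ᵥ p = 0)
    (hv : v ⬝ᵥ p = 0) (hw : w ⬝ᵥ p = 0) : p = 0 := by
  refine Matrix.eq_zero_of_mulVec_eq_zero h (funext fun i => ?_)
  fin_cases i
  · exact hu
  · exact hv
  · exact hw

/-- Complete `u`, `v` to a basis by `w`. Then `w ⬝ᵥ p ≠ 0`, so pairing with `p` reads off the third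
coordinate of `s`. -/
theorem exists_eq_add_of_dotProduct_eq_zero (h : crossProduct u v ≠ 0) (hp : p ≠ 0)
    (hu : u ⬝ᵥ p = 0) (hv : v ⬝ᵥ p = 0) (hs : s ⬝ᵥ p = 0) :
    ∃ α β : ℂ, s = α • u + β • v := by
  obtain ⟨w, hw⟩ := exists_det_ne_zero h
  obtain ⟨x, hx⟩ := exists_coords hw s
  have hwp : w ⬝ᵥ p ≠ 0 := fun hwp => hp (eq_zero_of_dotProduct_eq_zero hw hu hv hwp)
  have hx2 : x 2 = 0 := by
    rw [hx, add_dotProduct, add_dotProduct, smul_dotProduct, smul_dotProduct, smul_dotProduct,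
      hu, hv] at hs
    simpa [hwp] using hs
  exact ⟨x 0, x 1, by rw [hx, hx2, zero_smul, add_zero]⟩

theorem exists_dotProduct_of_crossProduct_ne_zero (h : crossProduct u v ≠ 0) :
    ∃ p, u ⬝ᵥ p = 0 ∧ v ⬝ᵥ p ≠ 0 := by
  obtain ⟨w, hw⟩ := exists_det_ne_zero h
  refine ⟨crossProduct w u, ?_, ?_⟩
  · rw [dot_cross_self]
  · rwa [triple_product_permutation, triple_product_permutation, dotProduct_crossProduct]

theorem exists_smul_of_forall_dotProduct (hu : u ≠ 0) (h : ∀ p, u ⬝ᵥ p = 0 → s ⬝ᵥ p = 0) :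
    ∃ c : ℂ, s = c • u := by
  have h0 : crossProduct u s = 0 := by
    by_contra hcon
    obtain ⟨p, hp, hsp⟩ := exists_dotProduct_of_crossProduct_ne_zero hcon
    exact hsp (h p hp)
  by_contra! hcon
  refine crossProduct_ne_zero_iff_linearIndependent.2 ?_ h0
  exact (LinearIndependent.pair_iff' hu).2 fun c hc => hcon c hc.symm

theorem crossProduct_ne_zero_of_mk_ne {hu : u ≠ 0} {hv : v ≠ 0}
    (h : Projectivization.mk ℂ (lin u) (lin_ne_zero hu) ≠
      Projectivization.mk ℂ (lin v) (lin_ne_zero hv)) : crossProduct u v ≠ 0 := by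
  rw [crossProduct_ne_zero_iff_linearIndependent, LinearIndependent.pair_iff' hu]
  rintro c rfl
  apply h
  rw [eq_comm, Projectivization.mk_eq_mk_iff']
  exact ⟨c, by rw [map_smul]⟩

end LinearAlgebra

/-! ### Configurations of at least four lines -/

section Trichotomy

variable {d : ℕ} {r : Fin d → Fin 3 → ℂ}

/-- Four of the given vectors are in general position. -/
def HasFrame (r : Fin d → Fin 3 → ℂ) : Prop :=
  ∃ (i₁ i₂ i₃ i₄ : Fin d) (α β γ : ℂ), α ≠ 0 ∧ β ≠ 0 ∧ γ ≠ 0 ∧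
    (rowMatrix (r i₁) (r i₂) (r i₃)).det ≠ 0 ∧ r i₄ = α • r i₁ + β • r i₂ + γ • r i₃

/-- Lines through two different vertices of a triangle: eliminating `r c` between the two
expressions writes `r j` in terms of `r a`, `r b`, `r i` with all coefficients nonzero. -/
theorem hasFrame_of_two {a b c i j : Fin d} (h : (rowMatrix (r a) (r b) (r c)).det ≠ 0)
    {β γ α' γ' : ℂ} (hβ : β ≠ 0) (hγ : γ ≠ 0) (hα' : α' ≠ 0) (hγ' : γ' ≠ 0)
    (hi : r i = β • r b + γ • r c) (hj : r j = α' • r a + γ' • r c) : HasFrame r := by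
  refine ⟨a, b, i, j, α', -(γ' / γ * β), γ' / γ, hα', ?_, ?_, ?_, ?_⟩
  · exact neg_ne_zero.2 (mul_ne_zero (div_ne_zero hγ' hγ) hβ)
  · exact div_ne_zero hγ' hγ
  · have : (rowMatrix (r a) (r b) (r i)).det = γ * (rowMatrix (r a) (r b) (r c)).det := by
      simp [hi, Matrix.det_fin_three]
      ring
    rw [this]
    exact mul_ne_zero hγ h
  · rw [hi, hj]
    ext k
    simp only [Pi.add_apply, Pi.smul_apply, smul_eq_mul]
    field_simp
    ring

/-- Use three nonconcurrent lines as a coordinate triangle. A line with no zero coordinate completes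
a frame. Otherwise every line passes through a vertex: either all lines except one side pass through
the same vertex, or two lines through different vertices give a frame by `hasFrame_of_two`. -/
theorem concurrent_or_near_pencil_or_hasFrame (hd : 4 ≤ d)
    (hr : ∀ i j, i ≠ j → crossProduct (r i) (r j) ≠ 0) :
    (∃ p : Fin 3 → ℂ, p ≠ 0 ∧ ∀ i, r i ⬝ᵥ p = 0) ∨
    (∃ (i₀ : Fin d) (p : Fin 3 → ℂ), p ≠ 0 ∧ (∀ i, i ≠ i₀ → r i ⬝ᵥ p = 0) ∧ r i₀ ⬝ᵥ p ≠ 0) ∨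
    HasFrame r := by
  by_cases hconc : ∃ p : Fin 3 → ℂ, p ≠ 0 ∧ ∀ i, r i ⬝ᵥ p = 0
  · exact Or.inl hconc
  refine Or.inr ?_
  push Not at hconc
  -- The cross product is the intersection point of lines `0` and `1`; line `k` misses it.
  obtain ⟨k, hk⟩ := hconc _ (hr ⟨0, by omega⟩ ⟨1, by omega⟩ (by simp))
  rw [dotProduct_crossProduct] at hk
  let idx : Fin 3 → Fin d := ![k, ⟨0, by omega⟩, ⟨1, by omega⟩]
  have hdet : (rowMatrix (r (idx 0)) (r (idx 1)) (r (idx 2))).det ≠ 0 := hk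
  choose x hx using fun i => exists_coords hdet (r i)
  by_cases hframe : ∃ i, x i 0 ≠ 0 ∧ x i 1 ≠ 0 ∧ x i 2 ≠ 0
  · obtain ⟨i, h0, h1, h2⟩ := hframe
    exact Or.inr ⟨_, _, _, i, _, _, _, h0, h1, h2, hdet, hx i⟩
  have hzero : ∀ i, ∃ j, x i j = 0 := by
    intro i
    by_contra! hcon
    exact hframe ⟨i, hcon 0, hcon 1, hcon 2⟩
  -- A line with two zero coordinates is a side of the triangle.
  have hone : ∀ (i : Fin d) (j j' j'' : Fin 3), j ≠ j' → j ≠ j'' → j' ≠ j'' → i ≠ idx j →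
      x i j' = 0 → x i j'' ≠ 0 := by
    intro i j j' j'' h1 h2 h3 hi h4 h5
    have : r i = x i j • r (idx j) := by
      rw [hx i, sum_three_of_ne (fun m => x i m • r (idx m)) h1 h2 h3, h4, h5, zero_smul, zero_smul,
        add_zero, add_zero]
    apply hr _ _ hi.symm
    rw [this, map_smul, cross_self, smul_zero]
  obtain ⟨i, hi⟩ : ∃ i, ∀ j, i ≠ idx j := by
    have : ¬ Function.Surjective idx := by
      intro hs
      have := Fintype.card_le_of_surjective _ hs
      simp only [Fintype.card_fin] at this
      omega
    simp only [Function.Surjective] at this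
    push Not at this
    obtain ⟨i, hi⟩ := this
    exact ⟨i, fun j => (hi j).symm⟩
  obtain ⟨j, hj⟩ := hzero i
  by_cases hall : ∀ i', i' ≠ idx j → x i' j = 0
  · left
    let A := rowMatrix (r (idx 0)) (r (idx 1)) (r (idx 2))
    -- The vertex opposite to side `j`, scaled so that pairing with it extracts coordinate `j`.
    let p : Fin 3 → ℂ := A⁻¹ *ᵥ Pi.single j 1
    have hAp : A *ᵥ p = Pi.single j 1 := by
      rw [Matrix.mulVec_mulVec, Matrix.mul_nonsing_inv A (isUnit_iff_ne_zero.2 hdet),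
        Matrix.one_mulVec]
    have hAp' : ∀ m, r (idx m) ⬝ᵥ p = (Pi.single j 1 : Fin 3 → ℂ) m := by
      intro m
      rw [← hAp]
      fin_cases m <;> rfl
    have hrp : ∀ i', r i' ⬝ᵥ p = x i' j := by
      intro i'
      conv_lhs => rw [hx i']
      rw [add_dotProduct, add_dotProduct, smul_dotProduct, smul_dotProduct, smul_dotProduct,
        hAp', hAp', hAp']
      fin_cases j <;> simp
    refine ⟨idx j, p, ?_, fun i' hi' => by rw [hrp, hall i' hi'], ?_⟩
    · intro hp
      have := hAp' j
      rw [hp] at this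
      simp at this
    · rw [hAp']
      simp
  · right
    push Not at hall
    obtain ⟨i', hi', hi'j⟩ := hall
    obtain ⟨j', hj'⟩ := hzero i'
    have hjj' : j ≠ j' := by
      rintro rfl
      exact hi'j hj'
    obtain ⟨j'', h1, h2⟩ : ∃ j'' : Fin 3, j ≠ j'' ∧ j' ≠ j'' := by
      fin_cases j <;> fin_cases j' <;> first | exact absurd rfl hjj' | decide
    have hdet' : (rowMatrix (r (idx j)) (r (idx j')) (r (idx j''))).det ≠ 0 := by
      intro h0
      apply hdet
      have hsq : ∀ a b c : Fin 3, a ≠ b → a ≠ c → b ≠ c →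
          (rowMatrix (r (idx a)) (r (idx b)) (r (idx c))).det =
            (rowMatrix (r (idx 0)) (r (idx 1)) (r (idx 2))).det ∨
          (rowMatrix (r (idx a)) (r (idx b)) (r (idx c))).det =
            -(rowMatrix (r (idx 0)) (r (idx 1)) (r (idx 2))).det := by
        intro a b c hab hac hbc
        fin_cases a <;> fin_cases b <;> fin_cases c <;>
          first
          | exact absurd rfl hab
          | exact absurd rfl hac
          | exact absurd rfl hbc
          | (left; simp [Matrix.det_fin_three]; ring1)
          | (right; simp [Matrix.det_fin_three]; ring1)
          | (left; rfl)
      rcases hsq j j' j'' hjj' h1 h2 with h | h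
      · rw [← h, h0]
      · rw [← neg_eq_zero, ← h, h0]
    have hij' : x i j' ≠ 0 := hone i j'' j j' h1.symm h2.symm hjj' (hi _) hj
    have hij'' : x i j'' ≠ 0 := hone i j' j j'' hjj'.symm h2 h1 (hi _) hj
    have hi'j'' : x i' j'' ≠ 0 := hone i' j j' j'' hjj' h1 h2 hi' hj'
    refine hasFrame_of_two hdet' hij' hij'' hi'j hi'j'' (i := i) (j := i') ?_ ?_
    · rw [hx i, sum_three_of_ne (fun m => x i m • r (idx m)) hjj' h1 h2, hj, zero_smul, zero_add]
    · rw [hx i', sum_three_of_ne (fun m => x i' m • r (idx m)) hjj' h1 h2, hj', zero_smul, add_zero]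

end Trichotomy

/-! ### Jacobian syzygies of products of lines -/

section Syzygies

variable {V : Type*} [AddCommGroup V] [Module ℂ V]

theorem derivation_prod {A ι : Type*} [CommRing A] [Algebra ℂ A] [DecidableEq ι]
    (D : Derivation ℂ A A) (s : Finset ι) (f : ι → A) :
    D (∏ i ∈ s, f i) = ∑ i ∈ s, D (f i) * ∏ j ∈ s.erase i, f j := by
  induction s using Finset.induction_on with
  | empty => simp
  | insert a s ha ih =>
    rw [Finset.prod_insert ha, D.leibniz, ih, Finset.sum_insert ha, Finset.erase_insert ha,
      smul_eq_mul, smul_eq_mul, Finset.mul_sum, add_comm, mul_comm]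
    congr 1
    refine Finset.sum_congr rfl fun i hi => ?_
    rw [Finset.erase_insert_of_ne (by rintro rfl; exact ha hi), Finset.prod_insert
      (fun h => ha (Finset.mem_of_mem_erase h))]
    ring

theorem pderiv_lin (i : Fin 3) (u : Fin 3 → ℂ) :
    MvPolynomial.pderiv i (lin u).1 = MvPolynomial.C (u i) := by
  rw [coe_lin]
  simp [MvPolynomial.pderiv_X, Pi.single_apply]

theorem sum_mul_pderiv_prodForm {d : ℕ} (r : Fin d → Fin 3 → ℂ)
    (a : Fin 3 → MvPolynomial (Fin 3) ℂ) :
    ∑ i, a i * MvPolynomial.pderiv i (prodForm fun j => lin (r j)).1 =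
      ∑ j, (∑ i, a i * MvPolynomial.C (r j i)) * ∏ k ∈ Finset.univ.erase j, (lin (r k)).1 := by
  change ∑ i, a i * MvPolynomial.pderiv i (∏ j : Fin d, (lin (r j)).1) = _
  simp only [derivation_prod, pderiv_lin, Finset.mul_sum, Finset.sum_mul]
  rw [Finset.sum_comm]
  simp only [mul_assoc]

theorem prod_polyFun_ne_zero {ι : Type*} (s : Finset ι) {f : ι → V → ℂ}
    (hf : ∀ i, IsPolyMap (f i)) (h : ∀ i ∈ s, ∃ v, f i v ≠ 0) : ∃ v, ∏ i ∈ s, f i v ≠ 0 := by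
  classical
  induction s using Finset.induction_on with
  | empty => exact ⟨0, by simp⟩
  | insert a s ha ih =>
    obtain ⟨v, hv⟩ := polyFun_mul_ne_zero (isPolyMap_complex.1 (hf a))
      (isPolyMap_complex.1 (IsPolyMap.prod (s := s) hf)) (h a (Finset.mem_insert_self _ _))
      (ih fun i hi => h i (Finset.mem_insert_of_mem hi))
    exact ⟨v, by rwa [Finset.prod_insert ha]⟩

theorem isPolyMap_eval (F : MvPolynomial (Fin 3) ℂ) :
    IsPolyMap fun p : Fin 3 → ℂ => MvPolynomial.eval p F := by
  induction F using MvPolynomial.induction_on with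
  | C c => simp only [MvPolynomial.eval_C]; fun_prop
  | add p q hp hq => simp only [map_add]; fun_prop
  | mul_X p i hp => simp only [map_mul, MvPolynomial.eval_X]; fun_prop

theorem eval_lin (p u : Fin 3 → ℂ) : MvPolynomial.eval p (lin u).1 = u ⬝ᵥ p := evalAt_lin p u

/-- A derivation annihilating a product of distinct lines is tangent to each of them. -/
theorem tangent_of_syzygy {d : ℕ} {r : Fin d → Fin 3 → ℂ}
    (hr : ∀ i j, i ≠ j → crossProduct (r i) (r j) ≠ 0) {a : Fin 3 → MvPolynomial (Fin 3) ℂ}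
    (ha : ∑ i, a i * MvPolynomial.pderiv i (prodForm fun j => lin (r j)).1 = 0) (j : Fin d)
    {p : Fin 3 → ℂ} (hp : r j ⬝ᵥ p = 0) : ∑ i, MvPolynomial.eval p (a i) * r j i = 0 := by
  -- On the plane where line `j` vanishes only the `j`-th Leibniz term survives. Its cofactor, the
  -- product of the other lines, is not identically zero there because the lines are distinct, so it
  -- can be cancelled by density.
  let W : Submodule ℂ (Fin 3 → ℂ) := LinearMap.ker (Matrix.mulVecLin (Matrix.of fun _ : Unit => r j))
  have hW : ∀ p, p ∈ W ↔ r j ⬝ᵥ p = 0 := by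
    intro p
    rw [LinearMap.mem_ker, Matrix.mulVecLin_apply]
    exact ⟨fun h => congrFun h (), fun h => funext fun _ => h⟩
  have hsub : IsPolyMap fun p : W => (p : Fin 3 → ℂ) := isPolyMap_linear W.subtype
  have hlin : ∀ k, IsPolyMap fun p : W => MvPolynomial.eval (p : Fin 3 → ℂ) (lin (r k)).1 :=
    fun k => (isPolyMap_eval _).comp hsub
  have ha' : ∀ i, IsPolyMap fun p : W => MvPolynomial.eval (p : Fin 3 → ℂ) (a i) :=
    fun i => (isPolyMap_eval _).comp hsub
  have h1 : IsPolyMap fun p : W =>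
      ∏ k ∈ Finset.univ.erase j, MvPolynomial.eval (p : Fin 3 → ℂ) (lin (r k)).1 :=
    IsPolyMap.prod hlin
  have h2 : IsPolyMap fun p : W => ∑ i, MvPolynomial.eval (p : Fin 3 → ℂ) (a i) * r j i := by
    fun_prop
  refine polyFun_eq_zero_of_mul (isPolyMap_complex.1 h1) (isPolyMap_complex.1 h2)
    (prod_polyFun_ne_zero _ hlin fun k hk => ?_) (fun q hq => ?_) ⟨p, (hW p).2 hp⟩
  · obtain ⟨q, hq, hkq⟩ := exists_dotProduct_of_crossProduct_ne_zero
      (hr j k (Finset.ne_of_mem_erase hk).symm)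
    exact ⟨⟨q, (hW q).2 hq⟩, by rwa [eval_lin]⟩
  · rw [sum_mul_pderiv_prodForm] at ha
    have hev := congrArg (MvPolynomial.eval (q : Fin 3 → ℂ)) ha
    rw [map_sum, Finset.sum_eq_single j] at hev
    · simp only [map_mul, map_sum, MvPolynomial.eval_C, map_prod, map_zero] at hev
      exact (mul_eq_zero.1 hev).resolve_right hq
    · intro k _ hkj
      rw [map_mul, map_prod, Finset.prod_eq_zero (Finset.mem_erase.2 ⟨hkj.symm, Finset.mem_univ j⟩)
        (by rw [eval_lin]; exact (hW _).1 q.2), mul_zero]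
    · simp

variable {d : ℕ} {r : Fin d → Fin 3 → ℂ} (hr0 : ∀ i, r i ≠ 0)

theorem mdr_psi_lines : mdr (psi (lines r hr0)) =
    sInf {m | HasJacobianSyzygy (prodForm fun j => lin (r j)).1 m} := by
  rw [psi_lines, mdr_mk]

theorem concurrent_lines :
    Concurrent (lines r hr0) ↔ ∃ p : Fin 3 → ℂ, p ≠ 0 ∧ ∀ i, r i ⬝ᵥ p = 0 := by
  have h : ∀ p i, MvPolynomial.eval p ((lines r hr0 i).rep).1 = 0 ↔ r i ⬝ᵥ p = 0 := by
    intro p i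
    obtain ⟨c, hc⟩ := Projectivization.exists_smul_eq_mk_rep ℂ (lin (r i)) (lin_ne_zero (hr0 i))
    change evalAt p (Projectivization.mk ℂ (lin (r i)) _).rep = 0 ↔ _
    rw [← hc, Units.smul_def, map_smul, evalAt_lin, smul_eq_mul, mul_eq_zero]
    simp
  simp only [Concurrent, h]

/-- A degree-zero syzygy is a constant vector field `p`; it is tangent to a line exactly when the
line passes through the point `p`. -/
theorem hasJacobianSyzygy_zero_iff (hr : ∀ i j, i ≠ j → crossProduct (r i) (r j) ≠ 0) :
    HasJacobianSyzygy (prodForm fun j => lin (r j)).1 0 ↔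
      ∃ p : Fin 3 → ℂ, p ≠ 0 ∧ ∀ i, r i ⬝ᵥ p = 0 := by
  constructor
  · rintro ⟨a, ha0, ha⟩
    have hC : ∀ i, ∃ c : ℂ, (a i).1 = MvPolynomial.C c := fun i =>
      ⟨_, (MvPolynomial.totalDegree_eq_zero_iff_eq_C).1
        (Nat.le_zero.1 (MvPolynomial.IsHomogeneous.totalDegree_le (a i).2))⟩
    choose c hc using hC
    refine ⟨c, fun h0 => ha0 (funext fun i => Subtype.ext ?_), fun j => ?_⟩
    · rw [hc, h0]
      simp
    · have := tangent_of_syzygy hr ha j (p := 0) (by simp)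
      simp only [hc, MvPolynomial.eval_C] at this
      rw [dotProduct_comm]
      exact this
  · rintro ⟨p, hp, h⟩
    refine ⟨fun i => ⟨MvPolynomial.C (p i), MvPolynomial.isHomogeneous_C _ _⟩, fun h0 => ?_, ?_⟩
    · apply hp
      ext i
      have := congrArg Subtype.val (congrFun h0 i)
      simpa using this
    · dsimp only
      rw [sum_mul_pderiv_prodForm]
      refine Finset.sum_eq_zero fun j _ => ?_
      simp only [← map_mul, ← map_sum]
      have : ∑ i, p i * r j i = 0 := by
        rw [← h j, dotProduct_comm]; rfl
      rw [this, map_zero, zero_mul]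

/-- The derivative along `p` kills every pencil line, so multiplied by the exceptional line it sends
`f` to `(r i₀ ⬝ᵥ p) • f`. The Euler field sends `f` to `d • f`, and the matching combination
annihilates `f`. -/
theorem hasJacobianSyzygy_one_of_near_pencil (hd : d ≠ 0) (i₀ : Fin d) {p : Fin 3 → ℂ}
    (h : ∀ i, i ≠ i₀ → r i ⬝ᵥ p = 0) (h₀ : r i₀ ⬝ᵥ p ≠ 0) :
    HasJacobianSyzygy (prodForm fun j => lin (r j)).1 1 := by
  let a : Fin 3 → Form 1 := fun i =>
    lin (((d : ℂ) * p i) • r i₀ - (r i₀ ⬝ᵥ p) • Pi.single i 1)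
  have hcoe : ∀ i, (a i).1 = MvPolynomial.C ((d : ℂ) * p i) * (lin (r i₀)).1 -
      MvPolynomial.C (r i₀ ⬝ᵥ p) * MvPolynomial.X i := by
    intro i
    have hX : (lin (Pi.single i 1)).1 = MvPolynomial.X i := by
      rw [coe_lin, Finset.sum_eq_single i]
      · simp
      · intro j _ hj
        simp [Pi.single_eq_of_ne hj]
      · simp
    simp only [a, map_sub, map_smul]
    rw [← hX, ← MvPolynomial.smul_eq_C_mul, ← MvPolynomial.smul_eq_C_mul]
    rfl
  refine ⟨a, fun ha => ?_, ?_⟩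
  · have hrow : ∀ i, ((d : ℂ) * p i) • r i₀ = (r i₀ ⬝ᵥ p) • Pi.single i 1 := fun i => by
      have h1 : a i = 0 := congrFun ha i
      exact sub_eq_zero.1 (lin_injective (by rw [map_zero]; exact h1))
    have h00 := congrFun (hrow 0) 1
    have h10 := congrFun (hrow 0) 0
    have h11 := congrFun (hrow 1) 1
    simp at h00 h10 h11
    rcases h00 with (h00 | h00) | h00
    · exact hd h00
    · rw [h00] at h10
      exact h₀ (by simpa using h10.symm)
    · rw [h00] at h11
      exact h₀ (by simpa using h11.symm)
  · simp only [hcoe, sub_mul, Finset.sum_sub_distrib]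
    have hE := (MvPolynomial.IsHomogeneous.sum_X_mul_pderiv (prodForm fun j => lin (r j)).2)
    have h2 : ∑ i, MvPolynomial.C (r i₀ ⬝ᵥ p) * MvPolynomial.X i *
        MvPolynomial.pderiv i (prodForm fun j => lin (r j)).1 =
        MvPolynomial.C (r i₀ ⬝ᵥ p) * (d • (prodForm fun j => lin (r j)).1) := by
      rw [← hE, Finset.mul_sum]
      simp only [mul_assoc]
    have h1 : ∑ i, MvPolynomial.C ((d : ℂ) * p i) * (lin (r i₀)).1 *
        MvPolynomial.pderiv i (prodForm fun j => lin (r j)).1 =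
        MvPolynomial.C (r i₀ ⬝ᵥ p) * (d • (prodForm fun j => lin (r j)).1) := by
      rw [sum_mul_pderiv_prodForm, Finset.sum_eq_single i₀]
      · have hprod : (prodForm fun j => lin (r j)).1 =
            (lin (r i₀)).1 * ∏ k ∈ Finset.univ.erase i₀, (lin (r k)).1 :=
          (Finset.mul_prod_erase Finset.univ (fun k => (lin (r k)).1) (Finset.mem_univ i₀)).symm
        have hsum : ∑ i, MvPolynomial.C ((d : ℂ) * p i) * (lin (r i₀)).1 *
            MvPolynomial.C (r i₀ i) = MvPolynomial.C (d * (r i₀ ⬝ᵥ p)) * (lin (r i₀)).1 := by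
          rw [dotProduct, Finset.mul_sum, map_sum, Finset.sum_mul]
          refine Finset.sum_congr rfl fun i _ => ?_
          simp only [map_mul]
          ring
        rw [hsum, hprod, nsmul_eq_mul, map_mul]
        simp only [map_natCast]
        ring
      · intro j _ hj
        have : ∑ i, MvPolynomial.C ((d : ℂ) * p i) * (lin (r i₀)).1 *
            MvPolynomial.C (r j i) = MvPolynomial.C (d * (r j ⬝ᵥ p)) * (lin (r i₀)).1 := by
          rw [dotProduct, Finset.mul_sum, map_sum, Finset.sum_mul]
          refine Finset.sum_congr rfl fun i _ => ?_
          simp only [map_mul]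
          ring
        rw [this, h j hj, mul_zero, map_zero, zero_mul, zero_mul]
      · simp
    rw [h1, h2, sub_self]

/-- A linear vector field is a matrix `B`, and tangency makes each `r j` a left eigenvector. A basis
of eigenvectors together with a fourth having all coordinates nonzero forces `B` to be scalar, so
the syzygy is a multiple of the Euler field, which acts on `f ≠ 0` as `d ≠ 0`. -/
theorem not_hasJacobianSyzygy_one_of_hasFrame (hd : d ≠ 0)
    (hr : ∀ i j, i ≠ j → crossProduct (r i) (r j) ≠ 0) (hr0 : ∀ i, r i ≠ 0) (hF : HasFrame r) :
    ¬ HasJacobianSyzygy (prodForm fun j => lin (r j)).1 1 := by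
  rintro ⟨a, ha0, ha⟩
  choose b hb using fun i => lin_surjective (a i)
  let B : Matrix (Fin 3) (Fin 3) ℂ := Matrix.of b
  have heig : ∀ j, ∃ c : ℂ, r j ᵥ* B = c • r j := by
    intro j
    refine exists_smul_of_forall_dotProduct (hr0 j) fun p hp => ?_
    have := tangent_of_syzygy hr ha j hp
    simp only [← hb, eval_lin] at this
    rw [← Matrix.dotProduct_mulVec, dotProduct_comm]
    exact this
  choose c hc using heig
  obtain ⟨i₁, i₂, i₃, i₄, α, β, γ, hα, hβ, hγ, hdet, h₄⟩ := hF
  have h0 : (α * (c i₁ - c i₄)) • r i₁ + (β * (c i₂ - c i₄)) • r i₂ +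
      (γ * (c i₃ - c i₄)) • r i₃ = 0 := by
    have h1 := hc i₄
    rw [h₄, Matrix.add_vecMul, Matrix.add_vecMul, Matrix.smul_vecMul, Matrix.smul_vecMul,
      Matrix.smul_vecMul, hc, hc, hc] at h1
    rw [← sub_eq_zero] at h1
    rw [← h1]
    module
  obtain ⟨h1, h2, h3⟩ := coords_eq_zero hdet h0
  have h1' : c i₁ = c i₄ := by simpa [hα, sub_eq_zero] using h1
  have h2' : c i₂ = c i₄ := by simpa [hβ, sub_eq_zero] using h2
  have h3' : c i₃ = c i₄ := by simpa [hγ, sub_eq_zero] using h3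
  have hB : ∀ s : Fin 3 → ℂ, s ᵥ* B = c i₄ • s := by
    intro s
    obtain ⟨x, rfl⟩ := exists_coords hdet s
    rw [Matrix.add_vecMul, Matrix.add_vecMul, Matrix.smul_vecMul, Matrix.smul_vecMul,
      Matrix.smul_vecMul, hc, hc, hc, h1', h2', h3']
    module
  have hbi : ∀ i, b i = c i₄ • Pi.single i 1 := by
    intro i
    rw [← hB, Matrix.single_one_vecMul]
    rfl
  have hai : ∀ i, (a i).1 = MvPolynomial.C (c i₄) * MvPolynomial.X i := by
    intro i
    rw [← hb, hbi, map_smul, ← MvPolynomial.smul_eq_C_mul]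
    change c i₄ • (lin (Pi.single i 1)).1 = _
    rw [coe_lin, Finset.sum_eq_single i]
    · simp
    · intro j _ hj
      simp [Pi.single_eq_of_ne hj]
    · simp
  have hE := (MvPolynomial.IsHomogeneous.sum_X_mul_pderiv (prodForm fun j => lin (r j)).2)
  simp only [hai, mul_assoc, ← Finset.mul_sum, hE] at ha
  have hF0 : (prodForm fun j => lin (r j)).1 ≠ 0 := fun h =>
    prodForm_ne_zero (fun i => lin_ne_zero (hr0 i)) (Subtype.ext h)
  have hc0 : c i₄ = 0 := by
    simpa [hd, hF0, nsmul_eq_mul] using ha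
  exact ha0 (funext fun i => Subtype.ext (by rw [hai, hc0]; simp))

end Syzygies

/-! ### Dimensions of the orbits -/

section Dimensions

variable {d : ℕ} {r : Fin d → Fin 3 → ℂ} (hr0 : ∀ i, r i ≠ 0)

/-- The orbits of a tuple of lines and of their product both have dimension `k`. -/
def OrbitsHaveDim (l : Fin d → ℙ ℂ (Form 1)) (k : ℕ) : Prop :=
  dimProjPow (MulAction.orbit PGL(3, ℂ) l) = k ∧
    dimProj (MulAction.orbit PGL(3, ℂ) (psi l)) = k

theorem OrbitsHaveDim.of_le {l : Fin d → ℙ ℂ (Form 1)} {k : ℕ}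
    (h1 : (k : WithBot ℕ∞) ≤ dimProjPow (MulAction.orbit PGL(3, ℂ) l))
    (h2 : dimProj (MulAction.orbit PGL(3, ℂ) (psi l)) ≤ k) : OrbitsHaveDim l k :=
  ⟨le_antisymm ((dimProjPow_orbit_le l).trans h2) h1,
    le_antisymm h2 (h1.trans (dimProjPow_orbit_le l))⟩

theorem orbitsHaveDim_two_mul (hd : d ≤ 3) {u v w : Fin 3 → ℂ} (h : (rowMatrix u v w).det ≠ 0)
    (hr : ∀ i, r i = rowMatrix u v w (Fin.castLE hd i)) :
    OrbitsHaveDim (lines r hr0) (2 * d) :=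
  .of_le (two_mul_le_dimProjPow_orbit hr0 _ h hd hr) (dimProj_orbit_le_two_mul hr0)

theorem coeff_ne_zero_of_crossProduct {u v s : Fin 3 → ℂ} {α β : ℂ} (h : s = α • u + β • v)
    (hu : crossProduct u s ≠ 0) (hv : crossProduct v s ≠ 0) : α ≠ 0 ∧ β ≠ 0 := by
  constructor
  · rintro rfl
    apply hv
    rw [h, zero_smul, zero_add, map_smul, cross_self, smul_zero]
  · rintro rfl
    apply hu
    rw [h, zero_smul, add_zero, map_smul, cross_self, smul_zero]

theorem orbitsHaveDim_concurrent (hd : 3 ≤ d)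
    (hr : ∀ i j, i ≠ j → crossProduct (r i) (r j) ≠ 0) {p : Fin 3 → ℂ} (hp : p ≠ 0)
    (h : ∀ i, r i ⬝ᵥ p = 0) : OrbitsHaveDim (lines r hr0) 5 := by
  let i₁ : Fin d := ⟨0, by omega⟩
  let i₂ : Fin d := ⟨1, by omega⟩
  let i₃ : Fin d := ⟨2, by omega⟩
  have h12 : i₁ ≠ i₂ := by simp [i₁, i₂]
  have h13 : i₁ ≠ i₃ := by simp [i₁, i₃]
  have h23 : i₂ ≠ i₃ := by simp [i₂, i₃]
  choose α β hαβ using fun i =>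
    exists_eq_add_of_dotProduct_eq_zero (hr _ _ h12) hp (h i₁) (h i₂) (h i)
  obtain ⟨w, hw⟩ := exists_det_ne_zero (hr _ _ h12)
  obtain ⟨hα, hβ⟩ := coeff_ne_zero_of_crossProduct (hαβ i₃) (hr _ _ h13) (hr _ _ h23)
  exact .of_le (five_le_dimProjPow_orbit hr0 _ hw hα hβ (i₁ := i₁) (i₂ := i₂) rfl rfl (hαβ i₃))
    (dimProj_orbit_le_five hr0 (by omega) hαβ)

theorem orbitsHaveDim_near_pencil (hd : 4 ≤ d)
    (hr : ∀ i j, i ≠ j → crossProduct (r i) (r j) ≠ 0) {i₀ : Fin d} {p : Fin 3 → ℂ} (hp : p ≠ 0)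
    (h : ∀ i, i ≠ i₀ → r i ⬝ᵥ p = 0) (h₀ : r i₀ ⬝ᵥ p ≠ 0) :
    OrbitsHaveDim (lines r hr0) 7 := by
  classical
  have hcard : 2 < (Finset.univ.erase i₀).card := by
    rw [Finset.card_erase_of_mem (Finset.mem_univ _), Finset.card_univ, Fintype.card_fin]
    omega
  obtain ⟨i₁, i₂, i₃, m1, m2, m3, h12, h13, h23⟩ := Finset.two_lt_card_iff.1 hcard
  have k1 := h _ (Finset.ne_of_mem_erase m1)
  have k2 := h _ (Finset.ne_of_mem_erase m2)
  have hex : ∀ i, ∃ x y : ℂ, i ≠ i₀ → r i = x • r i₁ + y • r i₂ := by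
    intro i
    by_cases hi : i = i₀
    · exact ⟨0, 0, fun h => absurd hi h⟩
    · obtain ⟨x, y, hxy⟩ :=
        exists_eq_add_of_dotProduct_eq_zero (hr _ _ h12) hp k1 k2 (h i hi)
      exact ⟨x, y, fun _ => hxy⟩
  choose α β hαβ using hex
  have h3 := hαβ i₃ (Finset.ne_of_mem_erase m3)
  obtain ⟨hα, hβ⟩ := coeff_ne_zero_of_crossProduct h3 (hr _ _ h13) (hr _ _ h23)
  -- In a linear relation, pairing with `p` removes `r i₀`; the other two vectors are independent.
  have hdet : (rowMatrix (r i₁) (r i₂) (r i₀)).det ≠ 0 := by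
    intro h0
    obtain ⟨x, hx, hx0⟩ := Matrix.exists_vecMul_eq_zero_iff.2 h0
    have hxe : x 0 • r i₁ + x 1 • r i₂ + x 2 • r i₀ = 0 := by
      rw [← rowMatrix_smul_add, ← hx0]
      congr 1
      ext i
      fin_cases i <;> rfl
    have hx2 : x 2 = 0 := by
      have := congrArg (· ⬝ᵥ p) hxe
      simpa [add_dotProduct, smul_dotProduct, k1, k2, h₀] using this
    rw [hx2, zero_smul, add_zero] at hxe
    obtain ⟨w, hw⟩ := exists_det_ne_zero (hr _ _ h12)
    obtain ⟨hx0', hx1, -⟩ := coords_eq_zero hw (c := 0) (by rw [hxe, zero_smul, add_zero])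
    exact hx (funext fun i => by fin_cases i <;> assumption)
  exact .of_le
    (seven_le_dimProjPow_orbit hr0 _ hdet hα hβ (i₁ := i₁) (i₂ := i₂) (i₄ := i₀) rfl rfl h3 rfl)
    (dimProj_orbit_le_seven hr0 (by omega) i₀ hαβ)

theorem orbitsHaveDim_of_hasFrame (hd : d ≠ 0) (hF : HasFrame r) :
    OrbitsHaveDim (lines r hr0) 8 := by
  obtain ⟨i₁, i₂, i₃, i₄, α, β, γ, hα, hβ, hγ, hdet, h₄⟩ := hF
  exact .of_le (eight_le_dimProjPow_orbit hr0 _ hdet hα hβ hγ (i₁ := i₁) (i₂ := i₂) (i₃ := i₃)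
    rfl rfl rfl h₄) (dimProj_orbit_le_eight hr0 hd)

/-- Each geometric type fixes both `mdr` and the dimension, so the values of `mdr` tell the three
types apart. -/
theorem orbitsHaveDim_of_four_le (hd : 4 ≤ d)
    (hr : ∀ i j, i ≠ j → crossProduct (r i) (r j) ≠ 0) :
    (mdr (psi (lines r hr0)) = 0 ∧ OrbitsHaveDim (lines r hr0) 5) ∨
    (mdr (psi (lines r hr0)) = 1 ∧ OrbitsHaveDim (lines r hr0) 7) ∨
    (1 < mdr (psi (lines r hr0)) ∧ OrbitsHaveDim (lines r hr0) 8) := by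
  have hd0 : d ≠ 0 := by omega
  rw [mdr_psi_lines]
  set s := {m | HasJacobianSyzygy (prodForm fun j => lin (r j)).1 m}
  have hmem : HasJacobianSyzygy (prodForm fun j => lin (r j)).1 (sInf s) := Nat.sInf_mem (exists_hasJacobianSyzygy _)
  have hzero := hasJacobianSyzygy_zero_iff hr
  by_cases hconc : ∃ p : Fin 3 → ℂ, p ≠ 0 ∧ ∀ i, r i ⬝ᵥ p = 0
  · left
    refine ⟨Nat.le_zero.1 (Nat.sInf_le (hzero.2 hconc)), ?_⟩
    obtain ⟨p, hp, h⟩ := hconc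
    exact orbitsHaveDim_concurrent hr0 (by omega) hr hp h
  · right
    have h0 : sInf s ≠ 0 := fun h => hconc (hzero.1 (by rwa [h] at hmem))
    rcases concurrent_or_near_pencil_or_hasFrame hd hr with h | ⟨i₀, p, hp, h, h₀⟩ | hF
    · exact absurd h hconc
    · left
      have h1 : sInf s ≤ 1 := Nat.sInf_le (hasJacobianSyzygy_one_of_near_pencil hd0 i₀ h h₀)
      exact ⟨by omega, orbitsHaveDim_near_pencil hr0 hd hr hp h h₀⟩
    · right
      have h1 : sInf s ≠ 1 := fun h =>
        not_hasJacobianSyzygy_one_of_hasFrame hd0 hr hr0 hF (by rwa [h] at hmem)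
      exact ⟨by omega, orbitsHaveDim_of_hasFrame hr0 hd0 hF⟩

theorem orbitsHaveDim_one {r : Fin 1 → Fin 3 → ℂ} (hr0 : ∀ i, r i ≠ 0) :
    OrbitsHaveDim (lines r hr0) 2 := by
  obtain ⟨v, hv⟩ := exists_crossProduct_ne_zero (hr0 0)
  obtain ⟨w, hw⟩ := exists_det_ne_zero hv
  exact orbitsHaveDim_two_mul hr0 (by omega) hw fun i => by fin_cases i; rfl

theorem orbitsHaveDim_two {r : Fin 2 → Fin 3 → ℂ} (hr0 : ∀ i, r i ≠ 0)
    (hr : ∀ i j, i ≠ j → crossProduct (r i) (r j) ≠ 0) :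
    OrbitsHaveDim (lines r hr0) 4 := by
  obtain ⟨w, hw⟩ := exists_det_ne_zero (hr 0 1 (by simp))
  exact orbitsHaveDim_two_mul hr0 (by omega) hw fun i => by fin_cases i <;> rfl

theorem orbitsHaveDim_triangle {r : Fin 3 → Fin 3 → ℂ} (hr0 : ∀ i, r i ≠ 0)
    (h : ¬ ∃ p : Fin 3 → ℂ, p ≠ 0 ∧ ∀ i, r i ⬝ᵥ p = 0) :
    OrbitsHaveDim (lines r hr0) 6 := by
  have hdet : (rowMatrix (r 0) (r 1) (r 2)).det ≠ 0 := by
    intro h0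
    obtain ⟨p, hp, hp0⟩ := Matrix.exists_mulVec_eq_zero_iff.2 h0
    exact h ⟨p, hp, fun i => by fin_cases i; exacts [congrFun hp0 0, congrFun hp0 1, congrFun hp0 2]⟩
  exact orbitsHaveDim_two_mul hr0 le_rfl hdet fun i => by fin_cases i <;> rfl

end Dimensions

end LineArrangement

/-! ### Orbit dimensions of line arrangements -/

theorem proposition3p7 (d : ℕ) (hd : 1 ≤ d) (l : Fin d → ℙ ℂ (LineArrangement.Form 1))
    (hl : l ∈ LineArrangement.X d) (f : ℙ ℂ (LineArrangement.Form d))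
    (hf : f = LineArrangement.psi l) :
    LineArrangement.dimProjPow (MulAction.orbit PGL(3, ℂ) l) =
        LineArrangement.dimProj (MulAction.orbit PGL(3, ℂ) f) ∧
      (d = 1 → LineArrangement.dimProj (MulAction.orbit PGL(3, ℂ) f) = 2) ∧
      (d = 2 → LineArrangement.dimProj (MulAction.orbit PGL(3, ℂ) f) = 4) ∧
      (d = 3 →
        (LineArrangement.Concurrent l →
          LineArrangement.dimProj (MulAction.orbit PGL(3, ℂ) f) = 5) ∧
        (¬ LineArrangement.Concurrent l →
          LineArrangement.dimProj (MulAction.orbit PGL(3, ℂ) f) = 6)) ∧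
      (4 ≤ d →
        (LineArrangement.mdr f = 0 →
          LineArrangement.dimProj (MulAction.orbit PGL(3, ℂ) f) = 5) ∧
        (LineArrangement.mdr f = 1 →
          LineArrangement.dimProj (MulAction.orbit PGL(3, ℂ) f) = 7) ∧
        (1 < LineArrangement.mdr f →
          LineArrangement.dimProj (MulAction.orbit PGL(3, ℂ) f) = 8)) := by
  subst hf
  obtain ⟨r, hr0, rfl⟩ := LineArrangement.exists_eq_lines l
  -- Distinctness of the lines is used only in this form.
  have hr : ∀ i j, i ≠ j → crossProduct (r i) (r j) ≠ 0 := fun i j hij =>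
    LineArrangement.crossProduct_ne_zero_of_mk_ne (hu := hr0 i) (hv := hr0 j) (hl.ne hij)
  rw [LineArrangement.concurrent_lines]
  by_cases h4 : 4 ≤ d
  · rcases LineArrangement.orbitsHaveDim_of_four_le hr0 h4 hr with
      ⟨hm, h, h'⟩ | ⟨hm, h, h'⟩ | ⟨hm, h, h'⟩
    all_goals
      rw [h, h']
      refine ⟨rfl, by omega, by omega, by omega, fun _ => ⟨fun _ => ?_, fun _ => ?_, fun _ => ?_⟩⟩
      all_goals first | rfl | omega
  · obtain rfl | rfl | rfl : d = 1 ∨ d = 2 ∨ d = 3 := by omega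
    · obtain ⟨h, h'⟩ := LineArrangement.orbitsHaveDim_one hr0
      rw [h, h']
      exact ⟨rfl, fun _ => rfl, by omega, by omega, by omega⟩
    · obtain ⟨h, h'⟩ := LineArrangement.orbitsHaveDim_two hr0 hr
      rw [h, h']
      exact ⟨rfl, by omega, fun _ => rfl, by omega, by omega⟩
    · by_cases hconc : ∃ p : Fin 3 → ℂ, p ≠ 0 ∧ ∀ i, r i ⬝ᵥ p = 0
      · obtain ⟨p, hp, hc⟩ := hconc
        obtain ⟨h, h'⟩ := LineArrangement.orbitsHaveDim_concurrent hr0 le_rfl hr hp hc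
        rw [h, h']
        exact ⟨rfl, by omega, by omega, fun _ => ⟨fun _ => rfl, fun hn => absurd ⟨p, hp, hc⟩ hn⟩,
          by omega⟩
      · obtain ⟨h, h'⟩ := LineArrangement.orbitsHaveDim_triangle hr0 hconc
        rw [h, h']
        exact ⟨rfl, by omega, by omega, fun _ => ⟨fun hc => absurd hc hconc, fun _ => rfl⟩,
          by omega⟩
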